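/- Let $\mathbb T=\mathbb R/2\pi\mathbb Z$ and let $\alpha>1$. For $u\in L^2(\mathbb R\times\mathbb R\times\mathbb T)$ (complex-valued) let $$\widehat u(\tau,\xi,n)=\int_{\mathbb R}\int_{\mathbb R}\int_{\mathbb T}u(t,x,y)\,e^{-i(t\tau+x\xi+ny)}\,dy\,dx\,dt,\qquad (\tau,\xi,n)\in\mathbb R\times\mathbb R\times\mathbb Z,$$ be its space-time Fourier transform (in the $L^2$ sense), and for $K>0$ put $$\mathcal H^-_K=\Big\{(\tau,\xi,n)\in\mathbb R\times\mathbb R\times\mathbb Z:\ \tfrac12K\le\big|\tau+\xi^2-|n|^{2\alpha}\big|\le 2K\Big\}.$$ Then there is a constant $c>0$ depending only on $\alpha$ such that for all $K_1,K_2>0$ with $\max\{K_1,K_2\}\ge 1$ (in particular for all $K_1,K_2\ge1$) and all $u_1,u_2\in L^2(\mathbb R\times\mathbb R\times\mathbb T)$ with $\operatorname{supp}\widehat{u_j}\subseteq\mathcal H^-_{K_j}$, $j=1,2$ (essential support), one has $$\|u_1u_2\|_{L^2(\mathbb R\times\mathbb R\times\mathbb T)}\le c\,(K_1K_2)^{1/2}\,\|u_1\|_{L^2(\mathbb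 R\times\mathbb R\times\mathbb T)}\,\|u_2\|_{L^2(\mathbb R\times\mathbb R\times\mathbb T)}.$$ -/

import Mathlib

open MeasureTheory Topology
open scoped FourierTransform ENNReal

noncomputable section

instance instFactTwoPiPos : Fact ((0 : ℝ) < 2 * Real.pi) := ⟨Real.two_pi_pos⟩

/-- The torus `𝕋 = ℝ / 2πℤ`, with Lebesgue measure of total mass `2π`. -/
abbrev Torus : Type := AddCircle (2 * Real.pi)

/-- The partial Fourier transform in the periodic variable,
`(t, x) ↦ ∫_𝕋 u(t, x, y) e^{-iny} dy`, as a function on `ℝ²` with its Euclidean structure. -/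
def torusFourier (u : ℝ × ℝ × Torus → ℂ) (n : ℤ) : WithLp 2 (ℝ × ℝ) → ℂ :=
  fun p => ∫ y : Torus, fourier (-n) y * u (p.fst, p.snd, y)

theorem memLp_torusFourier {u : ℝ × ℝ × Torus → ℂ} (hu : MemLp u 2 volume) (n : ℤ) :
    MemLp (torusFourier u n) 2 volume := by
  set F : (ℝ × ℝ) × Torus → ℂ := fun q => fourier (-n) q.2 * u (q.1.1, q.1.2, q.2) with hF
  have hassoc := volume_preserving_prodAssoc (α₁ := ℝ) (β₁ := ℝ) (γ₁ := Torus)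
  have hU : MemLp (fun q : (ℝ × ℝ) × Torus => u (q.1.1, q.1.2, q.2)) 2 volume :=
    hu.comp_measurePreserving hassoc
  have hFm : AEStronglyMeasurable F (volume.prod volume) := by
    refine AEStronglyMeasurable.mul ?_ hU.aestronglyMeasurable
    exact ((fourier (T := 2 * Real.pi) (-n)).continuous.comp
      continuous_snd).aestronglyMeasurable
  have hFL : MemLp F 2 (volume.prod volume) := by
    refine MemLp.of_le hU hFm (Filter.Eventually.of_forall fun q => ?_)
    simp only [hF, fourier_apply, norm_mul, Circle.norm_coe, one_mul, le_refl]
  have hg : MemLp (fun p : ℝ × ℝ => ∫ y : Torus, F (p, y)) 2 volume := by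
    refine ⟨hFm.integral_prod_right', ?_⟩
    rw [eLpNorm_lt_top_iff_lintegral_rpow_enorm_lt_top (by norm_num) (by norm_num)]
    have h2 := (eLpNorm_lt_top_iff_lintegral_rpow_enorm_lt_top (by norm_num) (by norm_num)).1
      hFL.2
    rw [lintegral_prod _ (hFm.enorm.pow_const _)] at h2
    have hfin : (volume : Measure Torus) Set.univ < ∞ := measure_lt_top _ _
    calc _ ≤ ∫⁻ p : ℝ × ℝ, (volume : Measure Torus) Set.univ *
          ∫⁻ y : Torus, ‖F (p, y)‖ₑ ^ (2 : ℝ≥0∞).toReal := by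
          refine lintegral_mono_ae ?_
          filter_upwards [hFm.prodMk_left] with p hp
          have h3 := ENNReal.lintegral_mul_le_Lp_mul_Lq (volume : Measure Torus)
            Real.HolderConjugate.two_two hp.enorm (aemeasurable_const (b := (1 : ℝ≥0∞)))
          have h4 := (enorm_integral_le_lintegral_enorm (μ := (volume : Measure Torus))
            (fun y => F (p, y)))
          have h5 : ‖∫ y : Torus, F (p, y)‖ₑ ≤
              (∫⁻ y : Torus, ‖F (p, y)‖ₑ ^ (2 : ℝ)) ^ (1 / (2 : ℝ)) *
              ((volume : Measure Torus) Set.univ) ^ (1 / (2 : ℝ)) := by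
            refine h4.trans ?_
            simpa using h3
          calc _ ≤ ((∫⁻ y : Torus, ‖F (p, y)‖ₑ ^ (2 : ℝ)) ^ (1 / (2 : ℝ)) *
              ((volume : Measure Torus) Set.univ) ^ (1 / (2 : ℝ))) ^ (2 : ℝ≥0∞).toReal := by
                gcongr
            _ = _ := by
                rw [ENNReal.mul_rpow_of_nonneg _ _ (by norm_num), ← ENNReal.rpow_mul,
                  ← ENNReal.rpow_mul]
                simp [mul_comm]
      _ < ∞ := by
          rw [lintegral_const_mul' _ _ hfin.ne]
          exact ENNReal.mul_lt_top hfin h2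
  exact hg.comp_measurePreserving (WithLp.volume_preserving_ofLp ℝ ℝ)

/-- The space-time Fourier transform of `u ∈ L²(ℝ × ℝ × 𝕋)`,
`û(τ, ξ, n) = ∫ u(t, x, y) e^{-i(tτ + xξ + ny)} dy dx dt`, the integral over `ℝ²` being understood
in the sense of the `L²` (Plancherel) Fourier transform. Mathlib's transform on `ℝ²` has the kernel
`e^{-2πi⟨v, w⟩}`, hence the division of the frequencies by `2π`. It is determined up to
almost everywhere equality. -/
def spaceTimeFourier (u : ℝ × ℝ × Torus → ℂ) (hu : MemLp u 2 volume) : ℝ × ℝ × ℤ → ℂ :=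
  fun q => (𝓕 ((memLp_torusFourier hu q.2.2).toLp (torusFourier u q.2.2)) :
    Lp ℂ 2 (volume : Measure (WithLp 2 (ℝ × ℝ))))
      (WithLp.toLp 2 (q.1 / (2 * Real.pi), q.2.1 / (2 * Real.pi)))

/-- The measure on the frequency space `ℝ × ℝ × ℤ`: Lebesgue measure on `ℝ × ℝ` times
counting measure on `ℤ`. -/
def freqMeasure : Measure (ℝ × ℝ × ℤ) :=
  (volume : Measure ℝ).prod ((volume : Measure ℝ).prod Measure.count)

/-- The (essential) support of a function defined up to almost everywhere equality: the complement
of the largest open set on which it vanishes almost everywhere. -/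
def essSupport {X : Type*} [TopologicalSpace X] [MeasurableSpace X] (μ : Measure X)
    (f : X → ℂ) : Set X :=
  {x | ∀ U ∈ 𝓝 x, ¬ (∀ᵐ y ∂μ, y ∈ U → f y = 0)}

theorem essSupport_subset_iff {X : Type*} [TopologicalSpace X] [SecondCountableTopology X]
    [MeasurableSpace X] (μ : Measure X) (f : X → ℂ) {S : Set X} (hS : IsClosed S) :
    essSupport μ f ⊆ S ↔ ∀ᵐ y ∂μ, y ∉ S → f y = 0 := by
  constructor
  · intro h
    have key : μ (Sᶜ ∩ {y | f y ≠ 0}) = 0 := by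
      refine measure_null_of_locally_null _ fun x hx => ?_
      have hx' : x ∉ essSupport μ f := fun hh => hx.1 (h hh)
      simp only [essSupport, Set.mem_ofPred_eq, not_forall, not_not] at hx'
      obtain ⟨U, hU, hU0⟩ := hx'
      refine ⟨U ∩ (Sᶜ ∩ {y | f y ≠ 0}),
        Filter.inter_mem (mem_nhdsWithin_of_mem_nhds hU) self_mem_nhdsWithin, ?_⟩
      refine measure_mono_null ?_ (ae_iff.1 hU0)
      rintro y ⟨hyU, -, hy⟩
      simp only [Set.mem_ofPred_eq, not_forall]
      exact ⟨hyU, hy⟩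
    rw [ae_iff]
    refine measure_mono_null ?_ key
    intro y hy
    simp only [Set.mem_ofPred_eq, not_forall] at hy
    exact ⟨hy.1, hy.2⟩
  · intro h x hx
    by_contra hxS
    exact hx Sᶜ (hS.isOpen_compl.mem_nhds hxS) h

/-- The region `½ K ≤ |τ + ξ² - |n|^{2α}| ≤ 2K` around the hyperbolic characteristic surface. -/
def hyperbolicRegion (α K : ℝ) : Set (ℝ × ℝ × ℤ) :=
  {q | K / 2 ≤ |q.1 + q.2.1 ^ 2 - |(q.2.2 : ℝ)| ^ (2 * α)| ∧
    |q.1 + q.2.1 ^ 2 - |(q.2.2 : ℝ)| ^ (2 * α)| ≤ 2 * K}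

end

open scoped Convolution

/-! By Plancherel, the norm of a product is the norm of the convolution of the transforms.
Cauchy–Schwarz (`lintegral_sq_lintegral_mul_sub_le`) then leaves one task: to bound, uniformly in
`z`, the measure of the frequencies `q` with `q` in the first region and `z - q` in the second.

That bound, `exists_measure_scaledPhase_inter_le`, is proved with `n` fixed first. For fixed `ξ`
both conditions confine `τ` to intervals, so `τ` contributes at most a multiple of `min K₁ K₂`.
Adding the two conditions eliminates `τ` and leaves `|8π²(b - y/2)² - Aₙ| ≤ 4M`, where `ξ = 2πb` and
`M = max K₁ K₂`; such `b` have measure at most a multiple of `M / √(|Aₙ| + M)`. Up to a constant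
independent of `n`, `Aₙ` is `|n|^{2α} + |N - n|^{2α}`, which leaves any given level at least like
the power `2α` of the distance to two points symmetric about `N/2`
(`exists_abs_sub_rpow_le_abs_rpow_add_abs_rpow_sub`). As `M ≥ 1`, the contribution of `n` is at most
a multiple of `M` times a sum of two terms `(1 + |n - θ|)^(-α)`. These are summable uniformly in `θ`
because `α > 1`, and `min K₁ K₂ * max K₁ K₂ = K₁ K₂`.

The convolution formula is justified for densities cut off to bounded frequency sets; truncation,
almost everywhere convergence along a subsequence and Fatou give the general case
(`eLpNorm_mul_le_of_fourier_support`). -/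

/-! ### Square integrals and Parseval on the torus. -/

theorem eLpNorm_two_sq_eq_lintegral {X E : Type*} [MeasurableSpace X] [NormedAddCommGroup E]
    (μ : Measure X) (f : X → E) : eLpNorm f 2 μ ^ 2 = ∫⁻ x, ‖f x‖ₑ ^ 2 ∂μ := by
  have h := eLpNorm_nnreal_pow_eq_lintegral (f := f) (μ := μ) (p := 2) two_ne_zero
  have h2 : ((2 : NNReal) : ℝ) = ((2 : ℕ) : ℝ) := by norm_num
  rw [h2] at h
  simp only [ENNReal.rpow_natCast] at h
  exact_mod_cast h

theorem lintegral_enorm_sq_lt_top {X E : Type*} [MeasurableSpace X] [NormedAddCommGroup E]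
    {μ : Measure X} {f : X → E} (hf : MemLp f 2 μ) : ∫⁻ x, ‖f x‖ₑ ^ 2 ∂μ < ∞ := by
  rw [← eLpNorm_two_sq_eq_lintegral]
  exact ENNReal.pow_lt_top hf.2

theorem memLp_two_of_lintegral_enorm_sq_lt_top {X E : Type*} [MeasurableSpace X]
    [NormedAddCommGroup E] {μ : Measure X} {f : X → E} (hf : AEStronglyMeasurable f μ)
    (h : ∫⁻ x, ‖f x‖ₑ ^ 2 ∂μ < ∞) : MemLp f 2 μ := by
  rw [← eLpNorm_two_sq_eq_lintegral] at h
  exact ⟨hf, by simpa using h⟩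

/-- Parseval's identity on the torus. -/
theorem lintegral_enorm_sq_torus {w : Torus → ℂ} (hw : MemLp w 2 volume) :
    ∫⁻ y, ‖w y‖ₑ ^ 2 =
      (ENNReal.ofReal (2 * Real.pi))⁻¹ * ∑' n : ℤ, ‖∫ y : Torus, fourier (-n) y * w y‖ₑ ^ 2 := by
  have hpi := Real.two_pi_pos
  have hT0 : ENNReal.ofReal (2 * Real.pi) ≠ 0 := by simpa using hpi
  have hTt : ENNReal.ofReal (2 * Real.pi) ≠ ∞ := ENNReal.ofReal_ne_top
  have hw' : MemLp w 2 AddCircle.haarAddCircle := hw.haarAddCircle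
  have hs := hasSum_sq_fourierCoeff hw'.toLp
  have hc : ∀ n, fourierCoeff (hw'.toLp w) n =
      ((2 * Real.pi)⁻¹ : ℝ) • ∫ y : Torus, fourier (-n) y * w y := fun n => by
    rw [fourierCoeff_congr_ae hw'.coeFn_toLp, fourierCoeff, AddCircle.integral_haarAddCircle]
    simp
  have hi : ENNReal.ofReal (∫ t, ‖hw'.toLp w t‖ ^ 2 ∂AddCircle.haarAddCircle) =
      ∫⁻ t, ‖w t‖ₑ ^ 2 ∂AddCircle.haarAddCircle := by
    rw [ofReal_integral_eq_lintegral_ofReal]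
    · refine lintegral_congr_ae ?_
      filter_upwards [hw'.coeFn_toLp] with t ht
      rw [ht, ENNReal.ofReal_pow (norm_nonneg _), ofReal_norm]
    · exact (Lp.memLp (hw'.toLp w)).integrable_norm_pow two_ne_zero
    · exact Filter.Eventually.of_forall fun t => by positivity
  rw [← hs.tsum_eq, ENNReal.ofReal_tsum_of_nonneg (fun n => by positivity) hs.summable] at hi
  rw [AddCircle.volume_eq_smul_haarAddCircle, lintegral_smul_measure,
    ← AddCircle.volume_eq_smul_haarAddCircle, ← hi, smul_eq_mul, ← ENNReal.tsum_mul_left,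
    ← ENNReal.tsum_mul_left]
  refine tsum_congr fun n => ?_
  rw [hc, ENNReal.ofReal_pow (norm_nonneg _), ofReal_norm, enorm_smul, mul_pow, ← mul_assoc]
  congr 1
  rw [Real.enorm_of_nonneg (by positivity), ENNReal.ofReal_inv_of_pos hpi, pow_two, ← mul_assoc,
    ENNReal.mul_inv_cancel hT0 hTt, one_mul]

theorem lintegral_enorm_sq_prod_torus {X : Type*} [MeasurableSpace X] {μ : Measure X}
    [SFinite μ] {w : X × Torus → ℂ} (hw : AEStronglyMeasurable w (μ.prod volume))
    (hw2 : ∀ᵐ p ∂μ, MemLp (fun y => w (p, y)) 2 volume) :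
    ∫⁻ z, ‖w z‖ₑ ^ 2 ∂(μ.prod volume) = (ENNReal.ofReal (2 * Real.pi))⁻¹ *
      ∑' n : ℤ, ∫⁻ p, ‖∫ y : Torus, fourier (-n) y * w (p, y)‖ₑ ^ 2 ∂μ := by
  have hm : ∀ n : ℤ, AEStronglyMeasurable
      (fun p => ∫ y : Torus, fourier (-n) y * w (p, y)) μ := fun n => by
    refine AEStronglyMeasurable.integral_prod_right'
      (f := fun q : X × Torus => fourier (-n) q.2 * w q) ?_
    exact (((fourier (T := 2 * Real.pi) (-n)).continuous.measurable.comp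
      measurable_snd).aestronglyMeasurable).mul hw
  rw [lintegral_prod _ (hw.enorm.pow_const _), ← lintegral_tsum fun n => (hm n).enorm.pow_const _,
    ← lintegral_const_mul'' _ (AEMeasurable.tsum fun n => (hm n).enorm.pow_const _)]
  refine lintegral_congr_ae ?_
  filter_upwards [hw2] with p hp
  exact lintegral_enorm_sq_torus hp

theorem memLp_two_prodMk_left {X Y : Type*} [MeasurableSpace X] [MeasurableSpace Y]
    {μ : Measure X} {ν : Measure Y} [SFinite μ] [SFinite ν] {w : X × Y → ℂ}
    (hw : MemLp w 2 (μ.prod ν)) : ∀ᵐ p ∂μ, MemLp (fun y => w (p, y)) 2 ν := by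
  have h := lintegral_enorm_sq_lt_top hw
  rw [lintegral_prod _ (hw.1.enorm.pow_const _)] at h
  filter_upwards [hw.1.prodMk_left, ae_lt_top' (hw.1.enorm.pow_const 2).lintegral_prod_right' h.ne]
    with p hp hp2
  exact memLp_two_of_lintegral_enorm_sq_lt_top hp hp2

/-! ### The inverse Fourier transform on `L¹ ∩ L²`. -/

section InverseFourier

variable {E : Type*} [NormedAddCommGroup E] [InnerProductSpace ℝ E] [FiniteDimensional ℝ E]
  [MeasurableSpace E] [BorelSpace E]

theorem continuous_fourierInv_of_integrable {f : E → ℂ} (hf : Integrable f) :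
    Continuous (𝓕⁻ f) := by
  rw [← Real.Lp.fourierTransformInv_toLp (memLp_one_iff_integrable.2 hf)]
  exact BoundedContinuousFunction.continuous _

/-- Both sides agree when tested against smooth compactly supported functions: the `L²` transform is
compatible with the one on tempered distributions, and Fubini moves the integral transform onto the
test function. -/
theorem fourierInv_toLp_ae_eq {f : E → ℂ} (hf : Integrable f) (hf2 : MemLp f 2 volume) :
    ((𝓕⁻ (hf2.toLp f) : Lp ℂ 2 (volume : Measure E)) : E → ℂ) =ᵐ[volume] 𝓕⁻ f := by
  refine ae_eq_of_integral_contDiff_smul_eq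
    ((Lp.memLp _).locallyIntegrable (by norm_num))
    (continuous_fourierInv_of_integrable hf).locallyIntegrable fun g hg hgc => ?_
  have hg₁ : HasCompactSupport (Complex.ofRealCLM ∘ g) := hgc.comp_left rfl
  have hg₂ : ContDiff ℝ (⊤ : ℕ∞) (Complex.ofRealCLM ∘ g) := by fun_prop
  set φ : SchwartzMap E ℂ := hg₁.toSchwartzMap hg₂ with hφ
  have hφg : ∀ x, φ x = (g x : ℂ) := fun x => rfl
  have h := Lp.fourierInv_toTemperedDistribution_eq (hf2.toLp f)
  have h2 := congrArg (fun F => F φ) h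
  simp only [TemperedDistribution.fourierInv_apply, Lp.toTemperedDistribution_apply] at h2
  have h3 : ∫ x, (𝓕⁻ φ) x • hf2.toLp f x = ∫ x, (𝓕⁻ φ) x • f x := by
    refine integral_congr_ae ?_
    filter_upwards [hf2.coeFn_toLp] with x hx
    rw [hx]
  have h4 : ∫ x, (𝓕⁻ φ) x • f x = ∫ x, φ x • 𝓕⁻ f x := by
    have := VectorFourier.integral_fourierIntegral_smul_eq_flip (L := -innerₗ E)
      Real.continuous_fourierChar (μ := volume) (ν := volume)
      (continuous_inner (𝕜 := ℝ)).neg φ.integrable hf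
    rw [SchwartzMap.fourierInv_coe]
    have hflip : (-innerₗ E).flip = -innerₗ E := by
      ext x y
      simp [real_inner_comm]
    rw [hflip] at this
    exact this
  rw [h3, h4] at h2
  calc _ = ∫ x, φ x • (𝓕⁻ (hf2.toLp f) : Lp ℂ 2 (volume : Measure E)) x := by
        simp [hφg]
    _ = _ := by rw [← h2]; simp [hφg]

theorem lintegral_enorm_sq_fourierInv {f : E → ℂ} (hf : Integrable f) (hf2 : MemLp f 2 volume) :
    ∫⁻ x, ‖𝓕⁻ f x‖ₑ ^ 2 = ∫⁻ x, ‖f x‖ₑ ^ 2 := by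
  have h : ‖(𝓕⁻ (hf2.toLp f) : Lp ℂ 2 (volume : Measure E))‖ₑ = ‖hf2.toLp f‖ₑ := by
    have := (Lp.fourierTransformₗᵢ E ℂ).symm.norm_map (hf2.toLp f)
    rw [← ofReal_norm, ← ofReal_norm]
    exact congrArg _ this
  rw [Lp.enorm_def, Lp.enorm_def, eLpNorm_congr_ae (fourierInv_toLp_ae_eq hf hf2),
    eLpNorm_congr_ae hf2.coeFn_toLp] at h
  rw [← eLpNorm_two_sq_eq_lintegral, ← eLpNorm_two_sq_eq_lintegral, h]

theorem fourierInv_mul_convolution_eq {f g : E → ℂ} (hf : Integrable f) (hg : Integrable g)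
    (x : E) : 𝓕⁻ (f ⋆[ContinuousLinearMap.mul ℂ ℂ, volume] g) x = 𝓕⁻ f x * 𝓕⁻ g x := by
  simp only [Real.fourierInv_eq_fourier_neg]
  exact Real.fourier_mul_convolution_eq hf hg _

end InverseFourier

/-! ### Reduction of a convolution bound to a measure bound. -/

/-- A bilinear Cauchy–Schwarz inequality for convolutions on an additive group. -/
theorem lintegral_sq_lintegral_mul_sub_le {X : Type*} [AddCommGroup X] [MeasurableSpace X]
    [MeasurableAdd₂ X] [MeasurableSub₂ X] [MeasurableNeg X] (μ : Measure X)
    [SFinite μ] [μ.IsAddLeftInvariant]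
    {f g : X → ℝ≥0∞} (hf : Measurable f) (hg : Measurable g) {A : ℝ≥0∞}
    (hA : ∀ z, μ {x | f x ≠ 0 ∧ g (z - x) ≠ 0} ≤ A) :
    ∫⁻ z, (∫⁻ x, f x * g (z - x) ∂μ) ^ 2 ∂μ ≤
      A * ((∫⁻ x, f x ^ 2 ∂μ) * ∫⁻ x, g x ^ 2 ∂μ) := by
  have hcs : ∀ z, (∫⁻ x, f x * g (z - x) ∂μ) ^ 2 ≤
      A * ∫⁻ x, f x ^ 2 * g (z - x) ^ 2 ∂μ := fun z => by
    set S : Set X := {x | f x ≠ 0 ∧ g (z - x) ≠ 0} with hS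
    have hgz : Measurable fun x => g (z - x) := hg.comp (measurable_const.sub measurable_id)
    have hSm : MeasurableSet S :=
      (measurableSet_eq_fun hf measurable_const).compl.inter
        (measurableSet_eq_fun hgz measurable_const).compl
    -- Cauchy–Schwarz is applied to the indicator of `S` and the product; the first factor yields `μ
    -- S ≤ A`.
    have h := ENNReal.lintegral_mul_le_Lp_mul_Lq μ Real.HolderConjugate.two_two
      ((measurable_const (a := (1 : ℝ≥0∞))).indicator hSm).aemeasurable
      (hf.mul hgz).aemeasurable
    have h1 : ∫⁻ x, f x * g (z - x) ∂μ =
        ∫⁻ x, (S.indicator (fun _ => (1 : ℝ≥0∞)) * (f * fun x => g (z - x))) x ∂μ := by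
      refine lintegral_congr fun x => ?_
      by_cases hx : x ∈ S
      · simp [hx]
      · have : f x * g (z - x) = 0 := by
          by_contra h0
          exact hx ⟨left_ne_zero_of_mul h0, right_ne_zero_of_mul h0⟩
        simp [hx, this]
    have h2 : ∫⁻ x, S.indicator (fun _ => (1 : ℝ≥0∞)) x ^ (2 : ℝ) ∂μ = μ S := by
      rw [← lintegral_indicator_one hSm]
      refine lintegral_congr fun x => ?_
      by_cases hx : x ∈ S <;> simp [hx]
    rw [h1]
    refine (pow_le_pow_left' h 2).trans ?_
    rw [h2, mul_pow, ← ENNReal.rpow_natCast, ← ENNReal.rpow_natCast, ← ENNReal.rpow_mul,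
      ← ENNReal.rpow_mul]
    norm_num
    refine mul_le_mul' (hA z) (le_of_eq ?_)
    refine lintegral_congr fun x => ?_
    rw [mul_pow]
  have hm : Measurable fun q : X × X => f q.2 ^ 2 * g (q.1 - q.2) ^ 2 :=
    ((hf.comp measurable_snd).pow_const 2).mul
      ((hg.comp (measurable_fst.sub measurable_snd)).pow_const 2)
  calc _ ≤ ∫⁻ z, A * ∫⁻ x, f x ^ 2 * g (z - x) ^ 2 ∂μ ∂μ := lintegral_mono hcs
    _ = A * ∫⁻ z, ∫⁻ x, f x ^ 2 * g (z - x) ^ 2 ∂μ ∂μ :=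
        lintegral_const_mul _ hm.lintegral_prod_right'
    _ = A * ∫⁻ x, ∫⁻ z, f x ^ 2 * g (z - x) ^ 2 ∂μ ∂μ := by
        rw [lintegral_lintegral_swap hm.aemeasurable]
    _ = A * ∫⁻ x, f x ^ 2 * ∫⁻ z, g z ^ 2 ∂μ ∂μ := by
        congr 1
        refine lintegral_congr fun x => ?_
        have hgx : Measurable fun z => g (z - x) ^ 2 :=
          (hg.comp (measurable_id.sub_const x)).pow_const 2
        rw [lintegral_const_mul _ hgx,
          lintegral_sub_right_eq_self (fun z => g z ^ 2) x]
    _ = _ := by rw [lintegral_mul_const _ (hf.pow_const 2)]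

/-! ### Measure of the intersection of two phase regions. -/

/-- The sublevel sets of `|κ (b - β)² - A|` are contained in two short intervals. -/
theorem volume_abs_mul_sq_sub_le {κ : ℝ} (hκ : 1 ≤ κ) (β A : ℝ) {M : ℝ} (hM : 0 < M) :
    volume {b : ℝ | |κ * (b - β) ^ 2 - A| ≤ M} ≤ ENNReal.ofReal (4 * M / √(|A| + M)) := by
  set q := |A| + M with hq
  have hq0 : 0 < q := by positivity
  set s := √κ with hs
  have hs1 : 1 ≤ s := Real.one_le_sqrt.2 hκ
  have hs2 : s ^ 2 = κ := Real.sq_sqrt (by linarith)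
  set Q := √q with hQ
  have hQ0 : 0 < Q := Real.sqrt_pos.2 hq0
  have hQ2 : Q ^ 2 = q := Real.sq_sqrt hq0.le
  set r := Q - 2 * M / Q with hr
  have hsub : {b : ℝ | |κ * (b - β) ^ 2 - A| ≤ M} ⊆
      Set.Icc (β + r / s) (β + Q / s) ∪ Set.Icc (β - Q / s) (β - r / s) := by
    intro b hb
    have hb : |κ * (b - β) ^ 2 - A| ≤ M := hb
    obtain ⟨hb1, hb2⟩ := abs_le.1 hb
    set t := s * |b - β| with ht
    have ht0 : 0 ≤ t := by positivity
    have ht2 : t ^ 2 = κ * (b - β) ^ 2 := by rw [ht, mul_pow, hs2, sq_abs]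
    have htq : t ^ 2 ≤ q := by rw [ht2]; linarith [le_abs_self A]
    -- For `A < 0` the left side is not positive, since a point of the set forces `A + M ≥ 0`.
    have htl : q - 2 * M ≤ t ^ 2 := by
      have h0 : 0 ≤ t ^ 2 := by positivity
      rcases abs_cases A with ⟨h, -⟩ | ⟨h, -⟩ <;> linarith
    have htQ : t ≤ Q := Real.le_sqrt_of_sq_le htq
    -- From `t ≤ Q` one gets `Q (Q - t) ≤ Q² - t² ≤ 2M`.
    have htr : r ≤ t := by
      rw [hr, sub_le_comm, le_div_iff₀ hQ0]
      nlinarith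
    have h1 : |b - β| ≤ Q / s := by
      rw [le_div_iff₀ (by linarith)]; linarith
    have h2 : r / s ≤ |b - β| := by
      rw [div_le_iff₀ (by linarith)]; linarith
    rcases abs_cases (b - β) with ⟨h, -⟩ | ⟨h, -⟩
    · left; constructor <;> linarith
    · right; constructor <;> linarith
  have hlen : Q / s - r / s ≤ 2 * M / Q := by
    rw [← sub_div, hr, sub_sub_cancel]
    exact div_le_self (by positivity) hs1
  calc _ ≤ volume (Set.Icc (β + r / s) (β + Q / s)) + volume (Set.Icc (β - Q / s) (β - r / s)) :=
        (measure_mono hsub).trans (measure_union_le _ _)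
    _ ≤ ENNReal.ofReal (2 * M / Q) + ENNReal.ofReal (2 * M / Q) := by
        rw [Real.volume_Icc, Real.volume_Icc]
        gcongr <;> linarith
    _ = _ := by
        rw [← ENNReal.ofReal_add (by positivity) (by positivity)]
        congr 1; ring

/-- The derivative is nonnegative: for `s ≥ h` because `(s + h)^(p-1) ≥ s^(p-1)`, and for `s ≤ h` by
superadditivity of the power `p - 1` on `s + h = (h - s) + 2s`. Hence the two shifted powers
together increase at least as fast as `|s|^p`. -/
theorem monotoneOn_abs_rpow_add_abs_rpow_sub {p : ℝ} (hp : 2 < p) (h : ℝ) (hh : 0 ≤ h) :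
    MonotoneOn (fun s : ℝ => |s + h| ^ p + |s - h| ^ p - |s| ^ p) (Set.Ici 0) := by
  have hp1 : 1 < p := by linarith
  have hd : ∀ s : ℝ, HasDerivAt (fun s : ℝ => |s + h| ^ p + |s - h| ^ p - |s| ^ p)
      (p * |s + h| ^ (p - 2) * (s + h) + p * |s - h| ^ (p - 2) * (s - h)
        - p * |s| ^ (p - 2) * s) s := fun s =>
    (((hasDerivAt_abs_rpow (s + h) hp1).comp_add_const s h).add
      ((hasDerivAt_abs_rpow (s - h) hp1).comp_sub_const s h)).sub (hasDerivAt_abs_rpow s hp1)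
  refine monotoneOn_of_deriv_nonneg (convex_Ici 0)
    (fun s _ => (hd s).continuousAt.continuousWithinAt)
    (fun s _ => (hd s).differentiableAt.differentiableWithinAt) fun s hs => ?_
  rw [interior_Ici] at hs
  have hs : 0 < s := hs
  rw [(hd s).deriv]
  have hpos : ∀ x : ℝ, 0 < x → p * |x| ^ (p - 2) * x = p * x ^ (p - 1) := fun x hx => by
    rw [abs_of_pos hx, mul_assoc]
    congr 1
    nth_rewrite 2 [← Real.rpow_one x]
    rw [← Real.rpow_add hx]
    congr 1; ring
  have hnn : ∀ x : ℝ, 0 ≤ x → p * |x| ^ (p - 2) * x = p * x ^ (p - 1) := fun x hx => by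
    rcases hx.eq_or_lt with rfl | hx
    · rw [Real.zero_rpow (by linarith)]; simp
    · exact hpos x hx
  rw [hnn (s + h) (by linarith), hnn s hs.le]
  rcases le_total h s with hsh | hsh
  · rw [hnn (s - h) (by linarith)]
    have h1 : s ^ (p - 1) ≤ (s + h) ^ (p - 1) :=
      Real.rpow_le_rpow hs.le (by linarith) (by linarith)
    have h2 : 0 ≤ (s - h) ^ (p - 1) := Real.rpow_nonneg (by linarith) _
    nlinarith
  · have h0 : p * |s - h| ^ (p - 2) * (s - h) = - (p * (h - s) ^ (p - 1)) := by
      rw [← hnn (h - s) (by linarith), abs_sub_comm]; ring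
    rw [h0]
    have h1 : (h - s) ^ (p - 1) + (2 * s) ^ (p - 1) ≤ (s + h) ^ (p - 1) := by
      have := Real.add_rpow_le_rpow_add (a := h - s) (b := 2 * s) (by linarith) (by linarith)
        (p := p - 1) (by linarith)
      rwa [show h - s + 2 * s = s + h by ring] at this
    have h2 : s ^ (p - 1) ≤ (2 * s) ^ (p - 1) :=
      Real.rpow_le_rpow hs.le (by linarith) (by linarith)
    nlinarith

/-- The level sets of `s ↦ |s + h|ᵖ + |s - h|ᵖ` are concentrated near two symmetric points, with
polynomial separation. -/
theorem exists_abs_sub_rpow_le_abs_rpow_add_abs_rpow_sub {p : ℝ} (hp : 2 < p) (h c : ℝ) :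
    ∃ s₀ : ℝ, ∀ s : ℝ, |(|s| - s₀)| ^ p ≤ |(|s + h| ^ p + |s - h| ^ p - c)| := by
  wlog hh : 0 ≤ h generalizing h
  · obtain ⟨s₀, hs₀⟩ := this (-h) (by linarith)
    refine ⟨s₀, fun s => (hs₀ s).trans_eq ?_⟩
    rw [sub_neg_eq_add, ← sub_eq_add_neg, add_comm]
  set ψ : ℝ → ℝ := fun s => |s + h| ^ p + |s - h| ^ p with hψ
  have hψe : ∀ s, ψ |s| = ψ s := fun s => by
    rcases abs_cases s with ⟨h1, -⟩ | ⟨h1, -⟩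
    · rw [h1]
    · simp only [hψ, h1]
      rw [show -s + h = -(s - h) by ring, show -s - h = -(s + h) by ring, abs_neg, abs_neg,
        add_comm]
  -- Monotonicity gives `b^p - a^p ≤ ψ b - ψ a`, and superadditivity gives `(b - a)^p ≤ b^p - a^p`.
  have hinc : ∀ a b, 0 ≤ a → a ≤ b → (b - a) ^ p ≤ ψ b - ψ a := fun a b ha hab => by
    have h1 := monotoneOn_abs_rpow_add_abs_rpow_sub hp h hh (Set.mem_Ici.2 ha)
      (Set.mem_Ici.2 (ha.trans hab)) hab
    have h2 := Real.add_rpow_le_rpow_add (a := b - a) (b := a) (by linarith) ha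
      (p := p) (by linarith)
    rw [sub_add_cancel] at h2
    simp only [abs_of_nonneg ha, abs_of_nonneg (ha.trans hab)] at h1
    simp only [hψ]
    linarith
  have hcont : Continuous ψ := by
    have : (0 : ℝ) ≤ p := by linarith
    exact ((continuous_id.add continuous_const).abs.rpow_const fun _ => Or.inr this).add
      ((continuous_id.sub continuous_const).abs.rpow_const fun _ => Or.inr this)
  -- The centre solves `ψ s₀ = c` if the level is attained; below the minimum `ψ 0` the choice `0`
  -- works.
  have key : ∃ s₀, 0 ≤ s₀ ∧ (ψ s₀ = c ∨ (s₀ = 0 ∧ c ≤ ψ 0)) := by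
    rcases le_total c (ψ 0) with hc | hc
    · exact ⟨0, le_rfl, Or.inr ⟨rfl, hc⟩⟩
    · set b := c - ψ 0 + 1 with hb
      have hb1 : 1 ≤ b := by linarith
      have hbc : c ≤ ψ b := by
        have h1 := hinc 0 b le_rfl (by linarith)
        rw [sub_zero] at h1
        have h2 : b ^ (1 : ℝ) ≤ b ^ p := Real.rpow_le_rpow_of_exponent_le hb1 (by linarith)
        rw [Real.rpow_one] at h2
        linarith
      obtain ⟨s₀, hs₀, hs₀'⟩ := intermediate_value_Icc (by linarith : (0 : ℝ) ≤ b)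
        hcont.continuousOn ⟨hc, hbc⟩
      exact ⟨s₀, hs₀.1, Or.inl hs₀'⟩
  obtain ⟨s₀, hs₀, hc⟩ := key
  refine ⟨s₀, fun s => ?_⟩
  change _ ≤ |ψ s - c|
  rw [← hψe s]
  rcases le_total s₀ |s| with hs | hs
  · rw [abs_of_nonneg (sub_nonneg.2 hs)]
    refine (hinc s₀ |s| hs₀ hs).trans (le_trans ?_ (le_abs_self _))
    rcases hc with hc | ⟨rfl, hc⟩ <;> linarith
  · rw [abs_sub_comm, abs_of_nonneg (sub_nonneg.2 hs)]
    refine (hinc |s| s₀ (abs_nonneg _) hs).trans ?_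
    rcases hc with hc | ⟨rfl, hc⟩
    · rw [hc, abs_sub_comm]; exact le_abs_self _
    · have : |s| = 0 := le_antisymm hs (abs_nonneg _)
      rw [this, sub_self]; exact abs_nonneg _

/-- Translation by `⌊θ⌋` reduces to `0 ≤ θ < 1`, where one convergent series dominates. It is
centred at `-1/2` so that no term has a vanishing denominator. -/
theorem exists_tsum_one_add_abs_sub_rpow_le {α : ℝ} (hα : 1 < α) :
    ∃ C : ℝ, 0 < C ∧ ∀ θ : ℝ,
      ∑' n : ℤ, ENNReal.ofReal ((1 + |(n : ℝ) - θ|) ^ (-α)) ≤ ENNReal.ofReal C := by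
  have hsum : Summable fun n : ℤ => 1 / |(n : ℝ) + 1 / 2| ^ α :=
    (Real.summable_one_div_int_add_rpow (1 / 2) α).2 hα
  have hnn : ∀ n : ℤ, 0 ≤ 1 / |(n : ℝ) + 1 / 2| ^ α := fun n => by positivity
  have hne : ∀ n : ℤ, 0 < |(n : ℝ) + 1 / 2| := fun n => by
    rw [abs_pos]
    intro h
    have h2 : ((2 * n + 1 : ℤ) : ℝ) = 0 := by push_cast; linarith
    have : 2 * n + 1 = 0 := by exact_mod_cast h2
    omega
  refine ⟨2 ^ α * ∑' n : ℤ, 1 / |(n : ℝ) + 1 / 2| ^ α, ?_, fun θ => ?_⟩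
  · have : 0 < ∑' n : ℤ, 1 / |(n : ℝ) + 1 / 2| ^ α :=
      hsum.tsum_pos hnn 0 (by have := hne 0; positivity)
    positivity
  · rw [← (Equiv.addRight ⌊θ⌋).tsum_eq
      (fun n : ℤ => ENNReal.ofReal ((1 + |(n : ℝ) - θ|) ^ (-α))), ← tsum_mul_left,
      ENNReal.ofReal_tsum_of_nonneg (fun n => mul_nonneg (by positivity) (hnn n))
        (hsum.mul_left _)]
    refine ENNReal.tsum_le_tsum fun n => ENNReal.ofReal_le_ofReal ?_
    simp only [Equiv.coe_addRight, Int.cast_add]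
    have h1 := Int.floor_le θ
    have h2 := Int.lt_floor_add_one θ
    have h3 : |(n : ℝ) + 1 / 2| ≤ 2 * (1 + |(n : ℝ) + ⌊θ⌋ - θ|) := by
      rcases abs_cases ((n : ℝ) + 1 / 2) with ⟨h, h4⟩ | ⟨h, h4⟩ <;>
      rcases abs_cases ((n : ℝ) + ⌊θ⌋ - θ) with ⟨h', h5⟩ | ⟨h', h5⟩ <;> linarith
    rw [Real.rpow_neg (by positivity), ← one_div, mul_one_div,
      div_le_div_iff₀ (by positivity) (by have := hne n; positivity), one_mul,
      ← Real.mul_rpow (by norm_num) (by positivity)]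
    exact Real.rpow_le_rpow (abs_nonneg _) h3 (by linarith)

theorem volume_abs_two_pi_mul_add_le (d : ℝ) (ε : ℝ) (hε : ε = 1 ∨ ε = -1) {K : ℝ} (hK : 0 < K) :
    volume {a : ℝ | |ε * (2 * Real.pi * a) + d| ≤ 2 * K} ≤ ENNReal.ofReal K := by
  have hpi := Real.pi_gt_three
  have hsub : {a : ℝ | |ε * (2 * Real.pi * a) + d| ≤ 2 * K} ⊆
      Set.Icc ((-(ε * d) - 2 * K) / (2 * Real.pi)) ((-(ε * d) + 2 * K) / (2 * Real.pi)) := by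
    intro a ha
    obtain ⟨h1, h2⟩ := abs_le.1 (show |ε * (2 * Real.pi * a) + d| ≤ 2 * K from ha)
    constructor
    · rw [div_le_iff₀ (by positivity)]
      rcases hε with rfl | rfl <;> linarith
    · rw [le_div_iff₀ (by positivity)]
      rcases hε with rfl | rfl <;> linarith
  refine (measure_mono hsub).trans ?_
  rw [Real.volume_Icc, ← sub_div]
  refine ENNReal.ofReal_le_ofReal ?_
  rw [div_le_iff₀ (by positivity)]
  nlinarith

/-- The measure of the intersection of a parabolic strip with a reflected parabolic strip. -/
theorem volume_parabolic_strip_inter_le (x y f g : ℝ) {K₁ K₂ : ℝ} (h₁ : 0 < K₁) (h₂ : 0 < K₂) :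
    volume {v : ℝ × ℝ | |2 * Real.pi * v.1 + (2 * Real.pi * v.2) ^ 2 - f| ≤ 2 * K₁ ∧
      |2 * Real.pi * (x - v.1) + (2 * Real.pi * (y - v.2)) ^ 2 - g| ≤ 2 * K₂} ≤
    ENNReal.ofReal (min K₁ K₂) * ENNReal.ofReal (4 * (4 * max K₁ K₂) /
      √(|f + g - 2 * Real.pi * x - 2 * Real.pi ^ 2 * y ^ 2| + 4 * max K₁ K₂)) := by
  set M := max K₁ K₂ with hM
  have hM0 : 0 < M := h₁.trans_le (le_max_left _ _)
  set A := f + g - 2 * Real.pi * x - 2 * Real.pi ^ 2 * y ^ 2 with hA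
  set S := {v : ℝ × ℝ | |2 * Real.pi * v.1 + (2 * Real.pi * v.2) ^ 2 - f| ≤ 2 * K₁ ∧
      |2 * Real.pi * (x - v.1) + (2 * Real.pi * (y - v.2)) ^ 2 - g| ≤ 2 * K₂} with hS
  have hSm : MeasurableSet S := by
    have m1 : Measurable fun v : ℝ × ℝ => |2 * Real.pi * v.1 + (2 * Real.pi * v.2) ^ 2 - f| :=
      Continuous.measurable (by fun_prop)
    have m2 : Measurable fun v : ℝ × ℝ =>
        |2 * Real.pi * (x - v.1) + (2 * Real.pi * (y - v.2)) ^ 2 - g| :=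
      Continuous.measurable (by fun_prop)
    exact (measurableSet_le m1 measurable_const).inter (measurableSet_le m2 measurable_const)
  -- Adding the two strip conditions cancels the first coordinate; completing the square gives this
  -- condition on the second.
  set B := {b : ℝ | |8 * Real.pi ^ 2 * (b - y / 2) ^ 2 - A| ≤ 4 * M} with hB
  have hBm : MeasurableSet B :=
    measurableSet_le (Continuous.measurable (by fun_prop)) measurable_const
  have hsec : ∀ b : ℝ, volume ((fun a : ℝ => (a, b)) ⁻¹' S) ≤
      B.indicator (fun _ => ENNReal.ofReal (min K₁ K₂)) b := fun b => by
    by_cases hb : b ∈ B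
    · rw [Set.indicator_of_mem hb, ENNReal.ofReal_min]
      refine le_min ?_ ?_
      · refine (measure_mono ?_).trans
          (volume_abs_two_pi_mul_add_le ((2 * Real.pi * b) ^ 2 - f) 1 (Or.inl rfl) h₁)
        rintro a ⟨ha, -⟩
        rw [Set.mem_ofPred_eq]
        rw [show 1 * (2 * Real.pi * a) + ((2 * Real.pi * b) ^ 2 - f) =
          2 * Real.pi * a + (2 * Real.pi * b) ^ 2 - f by ring]
        exact ha
      · refine (measure_mono ?_).trans (volume_abs_two_pi_mul_add_le
          (2 * Real.pi * x + (2 * Real.pi * (y - b)) ^ 2 - g) (-1) (Or.inr rfl) h₂)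
        rintro a ⟨-, ha⟩
        rw [Set.mem_ofPred_eq]
        rw [show -1 * (2 * Real.pi * a) + (2 * Real.pi * x + (2 * Real.pi * (y - b)) ^ 2 - g) =
          2 * Real.pi * (x - a) + (2 * Real.pi * (y - b)) ^ 2 - g by ring]
        exact ha
    · rw [Set.indicator_of_notMem hb, nonpos_iff_eq_zero]
      suffices h : (fun a : ℝ => (a, b)) ⁻¹' S = ∅ by rw [h, measure_empty]
      rw [Set.eq_empty_iff_forall_notMem]
      rintro a ⟨ha1, ha2⟩
      refine hb ?_
      rw [hB, Set.mem_ofPred_eq]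
      have h3 : K₁ ≤ M := le_max_left _ _
      have h4 : K₂ ≤ M := le_max_right _ _
      rw [abs_le] at ha1 ha2 ⊢
      have h5 : 8 * Real.pi ^ 2 * (b - y / 2) ^ 2 - A =
          (2 * Real.pi * a + (2 * Real.pi * b) ^ 2 - f) +
            (2 * Real.pi * (x - a) + (2 * Real.pi * (y - b)) ^ 2 - g) := by
        rw [hA]; ring
      rw [h5]
      constructor <;> linarith [ha1.1, ha1.2, ha2.1, ha2.2]
  rw [Measure.volume_eq_prod, Measure.prod_apply_symm hSm]
  refine (lintegral_mono hsec).trans ?_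
  rw [lintegral_indicator hBm, setLIntegral_const]
  refine mul_le_mul_right (volume_abs_mul_sq_sub_le ?_ (y / 2) A (by positivity)) _
  nlinarith [Real.pi_gt_three]

/-- The phase `τ + ξ² - |n|^{2α}` at the frequency `(τ, ξ) = 2π q`. -/
noncomputable def scaledPhase (α : ℝ) (q : WithLp 2 (ℝ × ℝ) × ℤ) : ℝ :=
  2 * Real.pi * q.1.fst + (2 * Real.pi * q.1.snd) ^ 2 - |(q.2 : ℝ)| ^ (2 * α)

theorem measurable_scaledPhase (α : ℝ) : Measurable (scaledPhase α) := by
  have h1 : Measurable fun v : WithLp 2 (ℝ × ℝ) => v.fst :=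
    measurable_fst.comp (WithLp.measurable_ofLp 2 (ℝ × ℝ))
  have h2 : Measurable fun v : WithLp 2 (ℝ × ℝ) => v.snd :=
    measurable_snd.comp (WithLp.measurable_ofLp 2 (ℝ × ℝ))
  have h3 : Measurable fun n : ℤ => |(n : ℝ)| ^ (2 * α) := measurable_of_countable _
  exact (((h1.comp measurable_fst).const_mul _).add
    (((h2.comp measurable_fst).const_mul _).pow_const 2)).sub (h3.comp measurable_snd)

/-- Since `1 + |x| ≤ 2 max 1 |x|`, large `|x|` is absorbed by `|A|` and small `|x|` by `4M`. This is
where `max K₁ K₂ ≥ 1` enters. -/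
theorem div_sqrt_add_le {α x A M : ℝ} (hα : 1 < α) (hM : 1 ≤ M) (hA : |x| ^ (2 * α) ≤ |A|) :
    4 * (4 * M) / √(|A| + 4 * M) ≤ 16 * 2 ^ α * M * (1 + |x|) ^ (-α) := by
  have h1 : ((1 + |x|) ^ α) ^ 2 = (1 + |x|) ^ (2 * α) := by
    rw [← Real.rpow_natCast, ← Real.rpow_mul (by positivity)]
    congr 1; push_cast; ring
  have h2 : (1 + |x|) ^ (2 * α) ≤ 2 ^ (2 * α) * (|A| + 4 * M) := by
    have h3 : (1 + |x|) ^ (2 * α) ≤ (2 * max 1 |x|) ^ (2 * α) := by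
      refine Real.rpow_le_rpow (by positivity) ?_ (by linarith)
      linarith [le_max_left 1 |x|, le_max_right 1 |x|]
    rw [Real.mul_rpow (by norm_num) (by positivity)] at h3
    refine h3.trans (mul_le_mul_of_nonneg_left ?_ (by positivity))
    rcases le_total 1 |x| with h | h
    · rw [max_eq_right h]; linarith
    · rw [max_eq_left h, Real.one_rpow]; linarith [abs_nonneg A]
  have h4 : ((2 : ℝ) ^ α) ^ 2 = 2 ^ (2 * α) := by
    rw [← Real.rpow_natCast, ← Real.rpow_mul (by positivity)]
    congr 1; push_cast; ring
  have h5 : (1 + |x|) ^ α ≤ 2 ^ α * √(|A| + 4 * M) := by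
    refine le_of_sq_le_sq ?_ (by positivity)
    rw [mul_pow, Real.sq_sqrt (by positivity), h1, h4]
    exact h2
  rw [Real.rpow_neg (by positivity), ← div_eq_mul_inv,
    div_le_div_iff₀ (by positivity) (by positivity)]
  nlinarith [mul_le_mul_of_nonneg_left h5 (by positivity : (0 : ℝ) ≤ 16 * M)]

theorem one_add_abs_abs_sub_rpow_le (α s t : ℝ) :
    (1 + |(|s| - t)|) ^ (-α) ≤ (1 + |s - t|) ^ (-α) + (1 + |s + t|) ^ (-α) := by
  have h1 : 0 ≤ (1 + |s - t|) ^ (-α) := by positivity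
  have h2 : 0 ≤ (1 + |s + t|) ^ (-α) := by positivity
  rcases abs_cases s with ⟨h, -⟩ | ⟨h, -⟩
  · rw [h]; linarith
  · rw [h, show -s - t = -(s + t) by ring, abs_neg]; linarith

/-- Each slice in `n` is an intersection of parabolic strips; its bound decays like the power `-α`
of the distance of `n` to one of two centres, so the slices sum. -/
theorem exists_measure_scaledPhase_inter_le {α : ℝ} (hα : 1 < α) :
    ∃ C : ℝ, 0 < C ∧ ∀ K₁ K₂ : ℝ, 0 < K₁ → 0 < K₂ → 1 ≤ max K₁ K₂ →
      ∀ z : WithLp 2 (ℝ × ℝ) × ℤ,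
        ((volume : Measure (WithLp 2 (ℝ × ℝ))).prod Measure.count)
          {q | |scaledPhase α q| ≤ 2 * K₁ ∧ |scaledPhase α (z - q)| ≤ 2 * K₂} ≤
        ENNReal.ofReal (C * (K₁ * K₂)) := by
  obtain ⟨C, hC, hsum⟩ := exists_tsum_one_add_abs_sub_rpow_le hα
  refine ⟨16 * 2 ^ α * (C + C), by positivity, fun K₁ K₂ h₁ h₂ hK z => ?_⟩
  obtain ⟨⟨⟨x, y⟩⟩, N⟩ := z
  set M := max K₁ K₂ with hM
  set S := {q : WithLp 2 (ℝ × ℝ) × ℤ | |scaledPhase α q| ≤ 2 * K₁ ∧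
    |scaledPhase α ((WithLp.toLp 2 (x, y), N) - q)| ≤ 2 * K₂} with hS
  have hSm : MeasurableSet S := by
    refine MeasurableSet.inter ?_ ?_
    · exact measurableSet_le (measurable_scaledPhase α).abs measurable_const
    · exact measurableSet_le
        ((measurable_scaledPhase α).comp (measurable_const.sub measurable_id)).abs measurable_const
  -- With `s = n - N/2` and `h = N/2` the two powers are `|n|^{2α}` and `|n - N|^{2α}`; the level is
  -- the part of `A` that does not depend on `n`.
  obtain ⟨s₀, hs₀⟩ := exists_abs_sub_rpow_le_abs_rpow_add_abs_rpow_sub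
    (p := 2 * α) (by linarith) ((N : ℝ) / 2) (2 * Real.pi * x + 2 * Real.pi ^ 2 * y ^ 2)
  have hsec : ∀ n : ℤ, volume ((fun v : WithLp 2 (ℝ × ℝ) => (v, n)) ⁻¹' S) ≤
      ENNReal.ofReal (min K₁ K₂) * (ENNReal.ofReal (16 * 2 ^ α * M) *
        (ENNReal.ofReal ((1 + |(n : ℝ) - (N / 2 + s₀)|) ^ (-α)) +
          ENNReal.ofReal ((1 + |(n : ℝ) - (N / 2 - s₀)|) ^ (-α)))) := fun n => by
    have hv := (WithLp.volume_preserving_toLp ℝ ℝ).measure_preimage_equiv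
      (f := (MeasurableEquiv.toLp 2 (ℝ × ℝ))) ((fun v : WithLp 2 (ℝ × ℝ) => (v, n)) ⁻¹' S)
    rw [← hv]
    refine (volume_parabolic_strip_inter_le x y (|(n : ℝ)| ^ (2 * α))
      (|((N - n : ℤ) : ℝ)| ^ (2 * α)) h₁ h₂).trans ?_
    refine mul_le_mul_right ?_ _
    rw [← ENNReal.ofReal_add (by positivity) (by positivity),
      ← ENNReal.ofReal_mul (by positivity)]
    refine ENNReal.ofReal_le_ofReal ?_
    have h3 := hs₀ (n - N / 2)
    rw [show (n : ℝ) - N / 2 + N / 2 = n by ring, show (n : ℝ) - N / 2 - N / 2 = n - N by ring,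
      ← sub_sub] at h3
    rw [Int.cast_sub, abs_sub_comm (N : ℝ) n]
    refine (div_sqrt_add_le hα hK h3).trans (mul_le_mul_of_nonneg_left ?_ (by positivity))
    refine (one_add_abs_abs_sub_rpow_le α _ _).trans_eq ?_
    rw [← sub_sub, sub_add]
  rw [Measure.prod_apply_symm hSm, lintegral_count]
  refine (ENNReal.tsum_le_tsum hsec).trans ?_
  rw [ENNReal.tsum_mul_left, ENNReal.tsum_mul_left, ENNReal.tsum_add]
  calc _ ≤ ENNReal.ofReal (min K₁ K₂) * (ENNReal.ofReal (16 * 2 ^ α * M) *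
        (ENNReal.ofReal C + ENNReal.ofReal C)) := by
        gcongr <;> exact hsum _
    _ = _ := by
        rw [← ENNReal.ofReal_add hC.le hC.le, ← ENNReal.ofReal_mul (by positivity),
          ← ENNReal.ofReal_mul (by positivity), ← min_mul_max K₁ K₂]
        congr 1; ring

/-! ### Products of functions synthesised from finitely many torus modes. -/

theorem lintegral_prod_count {X : Type*} [MeasurableSpace X] {μ : Measure X} [SFinite μ]
    {F : X × ℤ → ℝ≥0∞} (hF : Measurable F) :
    ∫⁻ q, F q ∂(μ.prod Measure.count) = ∑' n : ℤ, ∫⁻ v, F (v, n) ∂μ := by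
  rw [lintegral_prod_symm' _ hF, lintegral_count]

theorem integral_fourier_neg_mul_fourier (n m : ℤ) :
    ∫ y : Torus, fourier (-n) y * fourier m y = if m = n then ((2 * Real.pi : ℝ) : ℂ) else 0 := by
  have h := fourierCoeff_fourier (T := 2 * Real.pi) m
  have h2 := congrFun h n
  rw [fourierCoeff, AddCircle.integral_haarAddCircle] at h2
  have h3 : (2 * Real.pi) ≠ 0 := Real.two_pi_pos.ne'
  have h4 := congrArg (fun z : ℂ => (2 * Real.pi) • z) h2
  simp only [smul_inv_smul₀ h3, smul_eq_mul] at h4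
  rw [h4]
  by_cases hmn : m = n
  · subst hmn; simp
  · simp [hmn, Ne.symm hmn]

section Synthesis

variable {E : Type*} [NormedAddCommGroup E] [InnerProductSpace ℝ E] [FiniteDimensional ℝ E]
  [MeasurableSpace E] [BorelSpace E]

/-- The function on `E × 𝕋` with Fourier transform `g`, where `g` is supported in the frequencies
`n ∈ s`. -/
noncomputable def fourierSynthesis (s : Finset ℤ) (g : E × ℤ → ℂ) : E × Torus → ℂ :=
  fun q => ∑ n ∈ s, ((2 * Real.pi : ℝ) : ℂ)⁻¹ * 𝓕⁻ (fun v => g (v, n)) q.1 * fourier n q.2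

theorem continuous_fourierSynthesis {s : Finset ℤ} {g : E × ℤ → ℂ}
    (hg : ∀ n, Integrable fun v => g (v, n)) : Continuous (fourierSynthesis s g) :=
  continuous_finsetSum _ fun n _ => (continuous_const.mul
    ((continuous_fourierInv_of_integrable (hg n)).comp continuous_fst)).mul
      ((fourier n).continuous.comp continuous_snd)

theorem integrable_torus_of_continuous {w : Torus → ℂ} (hw : Continuous w) : Integrable w :=
  hw.integrable_of_hasCompactSupport (HasCompactSupport.of_compactSpace w)

theorem integral_fourier_mul_fourierSynthesis {s : Finset ℤ} {g : E × ℤ → ℂ}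
    (hgs : ∀ n ∉ s, ∀ v, g (v, n) = 0) (n : ℤ) (p : E) :
    ∫ y : Torus, fourier (-n) y * fourierSynthesis s g (p, y) = 𝓕⁻ (fun v => g (v, n)) p := by
  simp only [fourierSynthesis, Finset.mul_sum]
  rw [integral_finsetSum _ fun m _ => integrable_torus_of_continuous (by fun_prop)]
  have h : ∀ m, ∫ y : Torus, fourier (-n) y * (((2 * Real.pi : ℝ) : ℂ)⁻¹ *
      𝓕⁻ (fun v => g (v, m)) p * fourier m y) =
      if n = m then 𝓕⁻ (fun v => g (v, m)) p else 0 := fun m => by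
    have h1 : ∀ y : Torus, fourier (-n) y * (((2 * Real.pi : ℝ) : ℂ)⁻¹ *
      𝓕⁻ (fun v => g (v, m)) p * fourier m y) = (((2 * Real.pi : ℝ) : ℂ)⁻¹ *
      𝓕⁻ (fun v => g (v, m)) p) * (fourier (-n) y * fourier m y) := fun y => by ring
    simp only [h1]
    rw [integral_const_mul, integral_fourier_neg_mul_fourier]
    have h2 : ((2 * Real.pi : ℝ) : ℂ) ≠ 0 := by exact_mod_cast Real.two_pi_pos.ne'
    by_cases hmn : m = n
    · rw [if_pos hmn, if_pos hmn.symm]; field_simp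
    · rw [if_neg hmn, if_neg (Ne.symm hmn), mul_zero]
  simp only [h]
  rw [Finset.sum_ite_eq]
  split_ifs with hn
  · rfl
  · have : (fun v => g (v, n)) = fun _ => 0 := funext fun v => hgs n hn v
    rw [this, Real.fourierInv_eq]
    simp

/-- The convolution theorem on `E × ℤ`. Only the first factor is expanded: each of its modes `m`
shifts the coefficient of the second factor from `n` to `n - m`. -/
theorem integral_fourier_mul_fourierSynthesis_mul {s t : Finset ℤ} {f g : E × ℤ → ℂ}
    (hgt : ∀ n ∉ t, ∀ v, g (v, n) = 0) (hf : ∀ n, Integrable fun v => f (v, n))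
    (hg : ∀ n, Integrable fun v => g (v, n)) (n : ℤ) (p : E) :
    ∫ y : Torus, fourier (-n) y * (fourierSynthesis s f (p, y) * fourierSynthesis t g (p, y)) =
      ((2 * Real.pi : ℝ) : ℂ)⁻¹ * 𝓕⁻ (∑ m ∈ s, ((fun v => f (v, m))
        ⋆[ContinuousLinearMap.mul ℂ ℂ, volume] (fun v => g (v, n - m)))) p := by
  have hgc : Continuous fun y : Torus => fourierSynthesis t g (p, y) :=
    (continuous_fourierSynthesis hg).comp (by fun_prop)
  have hconv : ∀ m, Integrable ((fun v => f (v, m))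
        ⋆[ContinuousLinearMap.mul ℂ ℂ, volume] (fun v => g (v, n - m))) := fun m =>
    (hf m).integrable_convolution _ (hg (n - m))
  have h1 : 𝓕⁻ (∑ m ∈ s, ((fun v => f (v, m))
      ⋆[ContinuousLinearMap.mul ℂ ℂ, volume] (fun v => g (v, n - m)))) p =
      ∑ m ∈ s, 𝓕⁻ (fun v => f (v, m)) p * 𝓕⁻ (fun v => g (v, n - m)) p := by
    rw [Finset.sum_congr rfl fun m _ =>
      (fourierInv_mul_convolution_eq (hf m) (hg (n - m)) p).symm]
    simp only [Real.fourierInv_eq, Finset.sum_apply, Finset.smul_sum]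
    refine integral_finsetSum _ fun m _ => ?_
    have := (Real.fourierIntegral_convergent_iff (μ := volume) (-p)).2 (hconv m)
    simpa using this
  rw [h1, Finset.mul_sum]
  have h2 : ∀ y : Torus,
      fourier (-n) y * (fourierSynthesis s f (p, y) * fourierSynthesis t g (p, y)) =
      ∑ m ∈ s, (((2 * Real.pi : ℝ) : ℂ)⁻¹ * 𝓕⁻ (fun v => f (v, m)) p) *
        (fourier (-(n - m)) y * fourierSynthesis t g (p, y)) := fun y => by
    simp only [fourierSynthesis.eq_1 s f, Finset.sum_mul, Finset.mul_sum]
    refine Finset.sum_congr rfl fun m _ => ?_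
    rw [neg_sub, sub_eq_add_neg, fourier_add]
    ring
  simp only [h2]
  rw [integral_finsetSum _ fun m _ => integrable_torus_of_continuous (by fun_prop)]
  refine Finset.sum_congr rfl fun m _ => ?_
  rw [integral_const_mul, integral_fourier_mul_fourierSynthesis hgt, mul_assoc]

theorem memLp_torus_of_continuous {w : Torus → ℂ} (hw : Continuous w) : MemLp w 2 volume :=
  hw.memLp_of_hasCompactSupport (HasCompactSupport.of_compactSpace w)

/-- The `L²` bilinear estimate for functions synthesised from compactly supported frequency
densities. -/
theorem lintegral_enorm_sq_fourierSynthesis_mul_le {s t : Finset ℤ} {f g : E × ℤ → ℂ}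
    (hfm : Measurable f) (hgm : Measurable g) (hgt : ∀ n ∉ t, ∀ v, g (v, n) = 0)
    (hf : ∀ n, Integrable fun v => f (v, n)) (hg : ∀ n, Integrable fun v => g (v, n))
    (hf2 : ∫⁻ q, ‖f q‖ₑ ^ 2 ∂((volume : Measure E).prod Measure.count) < ∞)
    (hg2 : ∫⁻ q, ‖g q‖ₑ ^ 2 ∂((volume : Measure E).prod Measure.count) < ∞)
    {A : ℝ≥0∞} (hAt : A ≠ ∞)
    (hA : ∀ z, ((volume : Measure E).prod Measure.count) {q | f q ≠ 0 ∧ g (z - q) ≠ 0} ≤ A) :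
    ∫⁻ z, ‖fourierSynthesis s f z * fourierSynthesis t g z‖ₑ ^ 2
        ∂((volume : Measure E).prod (volume : Measure Torus)) ≤
      (ENNReal.ofReal (2 * Real.pi))⁻¹ ^ 3 * (A *
        ((∫⁻ q, ‖f q‖ₑ ^ 2 ∂((volume : Measure E).prod Measure.count)) *
          ∫⁻ q, ‖g q‖ₑ ^ 2 ∂((volume : Measure E).prod Measure.count))) := by
  set μ := (volume : Measure E).prod (Measure.count : Measure ℤ) with hμ
  have hfc := continuous_fourierSynthesis (s := s) hf
  have hgc := continuous_fourierSynthesis (s := t) hg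
  set S : ℤ → E → ℂ := fun n => ∑ m ∈ s, ((fun v => f (v, m))
      ⋆[ContinuousLinearMap.mul ℂ ℂ, volume] (fun v => g (v, n - m))) with hS
  have hSi : ∀ n, Integrable (S n) := fun n =>
    integrable_finsetSum' _ fun m _ => (hf m).integrable_convolution _ (hg (n - m))
  set H : E × ℤ → ℝ≥0∞ := fun z => ∫⁻ q, ‖f q‖ₑ * ‖g (z - q)‖ₑ ∂μ with hH
  have hjm : Measurable fun q : (E × ℤ) × (E × ℤ) => ‖f q.2‖ₑ * ‖g (q.1 - q.2)‖ₑ :=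
    (hfm.comp measurable_snd).enorm.mul (hgm.comp (measurable_fst.sub measurable_snd)).enorm
  have hHm : Measurable H := hjm.lintegral_prod_right'
  -- The triangle inequality bounds the convolution by that of the absolute values on `E × ℤ`, to
  -- which the bilinear Cauchy–Schwarz bound applies.
  have hSH : ∀ n v, ‖S n v‖ₑ ≤ H (v, n) := fun n v => by
    have hz : Measurable fun q : E × ℤ => ‖f q‖ₑ * ‖g ((v, n) - q)‖ₑ :=
      hjm.comp (measurable_const.prodMk measurable_id)
    simp only [hH]
    rw [hμ, lintegral_prod_count hz]
    refine le_trans ?_ (ENNReal.sum_le_tsum s)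
    simp only [hS, Finset.sum_apply]
    refine (enorm_sum_le _ _).trans (Finset.sum_le_sum fun m _ => ?_)
    refine (enorm_integral_le_lintegral_enorm _).trans_eq (lintegral_congr fun w => ?_)
    simp [enorm_mul]
  have hHle : ∫⁻ z, H z ^ 2 ∂μ ≤ A * ((∫⁻ q, ‖f q‖ₑ ^ 2 ∂μ) * ∫⁻ q, ‖g q‖ₑ ^ 2 ∂μ) := by
    refine lintegral_sq_lintegral_mul_sub_le μ hfm.enorm hgm.enorm fun z => ?_
    simpa using hA z
  have hSsum : ∑' n, ∫⁻ v, ‖S n v‖ₑ ^ 2 ≤ ∫⁻ z, H z ^ 2 ∂μ := by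
    rw [hμ, lintegral_prod_count (hHm.pow_const 2)]
    exact ENNReal.tsum_le_tsum fun n => lintegral_mono fun v => pow_le_pow_left' (hSH n v) 2
  -- Finiteness puts each `S n` in `L²`, as Plancherel requires.
  have hfin : ∑' n, ∫⁻ v, ‖S n v‖ₑ ^ 2 < ∞ :=
    (hSsum.trans hHle).trans_lt
      (ENNReal.mul_lt_top hAt.lt_top (ENNReal.mul_lt_top hf2 hg2))
  have hS2 : ∀ n, MemLp (S n) 2 volume := fun n =>
    memLp_two_of_lintegral_enorm_sq_lt_top (hSi n).aestronglyMeasurable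
      ((ENNReal.le_tsum n).trans_lt hfin)
  rw [lintegral_enorm_sq_prod_torus
    (w := fun z => fourierSynthesis s f z * fourierSynthesis t g z)
    (hfc.mul hgc).aestronglyMeasurable
    (Filter.Eventually.of_forall fun p => memLp_torus_of_continuous
      ((hfc.mul hgc).comp (by fun_prop : Continuous fun y : Torus => (p, y))))]
  have hc : ∀ n, ∫⁻ p, ‖∫ y : Torus, fourier (-n) y *
      (fourierSynthesis s f (p, y) * fourierSynthesis t g (p, y))‖ₑ ^ 2 =
      (ENNReal.ofReal (2 * Real.pi))⁻¹ ^ 2 * ∫⁻ v, ‖S n v‖ₑ ^ 2 := fun n => by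
    simp only [integral_fourier_mul_fourierSynthesis_mul hgt hf hg, enorm_mul, mul_pow]
    rw [lintegral_const_mul' _ _ (ENNReal.pow_ne_top enorm_ne_top),
      lintegral_enorm_sq_fourierInv (hSi n) (hS2 n),
      enorm_inv (by exact_mod_cast Real.two_pi_pos.ne'), ← ofReal_norm, Complex.norm_real,
      Real.norm_of_nonneg Real.two_pi_pos.le]
  simp only [hc]
  rw [ENNReal.tsum_mul_left, ← mul_assoc, ← pow_succ']
  gcongr
  exact hSsum.trans hHle

end Synthesis

/-! ### Frequency truncation and passage to the limit. -/

section Truncation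

variable {E : Type*} [NormedAddCommGroup E]

/-- Restriction of a frequency density to the bounded set `‖v‖ ≤ N`, `|n| ≤ N`. -/
noncomputable def freqTruncation (N : ℕ) (G : E × ℤ → ℂ) : E × ℤ → ℂ :=
  (Metric.closedBall (0 : E) N ×ˢ (Finset.Icc (-(N : ℤ)) N : Set ℤ)).indicator G

theorem freqTruncation_of_notMem {N : ℕ} (G : E × ℤ → ℂ) {n : ℤ}
    (hn : n ∉ Finset.Icc (-(N : ℤ)) N) (v : E) : freqTruncation N G (v, n) = 0 :=
  Set.indicator_of_notMem (fun h => hn (by exact_mod_cast h.2)) _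

theorem freqTruncation_of_mem {N : ℕ} (G : E × ℤ → ℂ) {n : ℤ}
    (hn : n ∈ Finset.Icc (-(N : ℤ)) N) :
    (fun v => freqTruncation N G (v, n)) =
      (Metric.closedBall (0 : E) N).indicator fun v => G (v, n) := by
  funext v
  have hn' : n ∈ (Finset.Icc (-(N : ℤ)) N : Set ℤ) := by exact_mod_cast hn
  by_cases hv : v ∈ Metric.closedBall (0 : E) N
  · rw [Set.indicator_of_mem hv, freqTruncation, Set.indicator_of_mem (Set.mk_mem_prod hv hn')]
  · rw [Set.indicator_of_notMem hv, freqTruncation, Set.indicator_of_notMem fun h => hv h.1]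

theorem freqTruncation_eq_or (N : ℕ) (G : E × ℤ → ℂ) (q : E × ℤ) :
    freqTruncation N G q = G q ∨ freqTruncation N G q = 0 := by
  classical
  rw [freqTruncation, Set.indicator_apply]
  split_ifs <;> simp

theorem enorm_freqTruncation_le (N : ℕ) (G : E × ℤ → ℂ) (q : E × ℤ) :
    ‖freqTruncation N G q‖ₑ ≤ ‖G q‖ₑ := by
  rcases freqTruncation_eq_or N G q with h | h <;> simp [h]

theorem measurable_freqTruncation [MeasurableSpace E] [BorelSpace E] (N : ℕ)
    {G : E × ℤ → ℂ} (hG : Measurable G) :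
    Measurable (freqTruncation N G) :=
  hG.indicator (Metric.isClosed_closedBall.measurableSet.prod (Set.to_countable _).measurableSet)

variable [InnerProductSpace ℝ E] [FiniteDimensional ℝ E] [MeasurableSpace E] [BorelSpace E]

theorem memLp_freqTruncation (N : ℕ) {G : E × ℤ → ℂ} {n : ℤ}
    (hG : MemLp (fun v => G (v, n)) 2 volume) :
    MemLp (fun v => freqTruncation N G (v, n)) 2 volume := by
  by_cases hn : n ∈ Finset.Icc (-(N : ℤ)) N
  · rw [freqTruncation_of_mem G hn]
    exact hG.indicator Metric.isClosed_closedBall.measurableSet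
  · simp only [freqTruncation_of_notMem G hn]
    exact MemLp.zero'

/-- On a ball, `L²` is contained in `L¹`; this makes the pointwise inverse transform available. -/
theorem integrable_freqTruncation (N : ℕ) {G : E × ℤ → ℂ} {n : ℤ}
    (hG : MemLp (fun v => G (v, n)) 2 volume) :
    Integrable fun v => freqTruncation N G (v, n) := by
  by_cases hn : n ∈ Finset.Icc (-(N : ℤ)) N
  · rw [freqTruncation_of_mem G hn,
      integrable_indicator_iff Metric.isClosed_closedBall.measurableSet]
    have : IsFiniteMeasure (volume.restrict (Metric.closedBall (0 : E) N)) :=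
      ⟨by rw [Measure.restrict_apply_univ]; exact measure_closedBall_lt_top⟩
    exact (hG.restrict _).integrable (by norm_num)
  · simp only [freqTruncation_of_notMem G hn]
    exact integrable_zero _ _ _

/-- Dominated convergence: at each point the truncation is eventually exact. -/
theorem tendsto_lintegral_enorm_sq_freqTruncation_sub {G : E × ℤ → ℂ} (hG : Measurable G)
    (hG2 : ∫⁻ q, ‖G q‖ₑ ^ 2 ∂((volume : Measure E).prod Measure.count) ≠ ∞) :
    Filter.Tendsto (fun N : ℕ => ∫⁻ q, ‖freqTruncation N G q - G q‖ₑ ^ 2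
      ∂((volume : Measure E).prod Measure.count)) Filter.atTop (𝓝 0) := by
  have h := tendsto_lintegral_of_dominated_convergence
    (μ := (volume : Measure E).prod (Measure.count : Measure ℤ))
    (F := fun N q => ‖freqTruncation N G q - G q‖ₑ ^ 2) (f := fun _ => 0)
    (fun q => ‖G q‖ₑ ^ 2)
    (fun N => (((measurable_freqTruncation N hG).sub hG).enorm.pow_const 2))
    (fun N => Filter.Eventually.of_forall fun q => ?_) hG2
    (Filter.Eventually.of_forall fun q => ?_)
  · simpa using h
  · refine pow_le_pow_left' ?_ 2
    rcases freqTruncation_eq_or N G q with h | h <;> simp [h]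
  · refine tendsto_const_nhds.congr' ?_
    obtain ⟨K, hK⟩ := exists_nat_ge (max ‖q.1‖ |(q.2 : ℝ)|)
    filter_upwards [Filter.eventually_ge_atTop K] with N hN
    have hKN : (K : ℝ) ≤ N := by exact_mod_cast hN
    have h1 : ‖q.1‖ ≤ N := (le_max_left _ _).trans (hK.trans hKN)
    have h2 : |(q.2 : ℝ)| ≤ N := (le_max_right _ _).trans (hK.trans hKN)
    have h3 : |q.2| ≤ (N : ℤ) := by exact_mod_cast h2
    rw [freqTruncation, Set.indicator_of_mem, sub_self]
    · simp
    · refine ⟨by simpa using h1, ?_⟩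
      rw [Finset.mem_coe, Finset.mem_Icc]
      exact abs_le.1 h3

/-- Plancherel for a difference, mixing the pointwise inverse transform of `f` with an arbitrary
representative `g` of the `L²` transform of `h`. -/
theorem lintegral_enorm_sq_fourierInv_sub {f h g : E → ℂ} (hf : Integrable f)
    (hf2 : MemLp f 2 volume) (hh : MemLp h 2 volume)
    (hg : g =ᵐ[volume] (𝓕 (hh.toLp h) : Lp ℂ 2 (volume : Measure E))) :
    ∫⁻ v, ‖𝓕⁻ f v - h v‖ₑ ^ 2 = ∫⁻ v, ‖f v - g v‖ₑ ^ 2 := by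
  rw [← eLpNorm_two_sq_eq_lintegral volume (fun v => 𝓕⁻ f v - h v),
    ← eLpNorm_two_sq_eq_lintegral volume (fun v => f v - g v)]
  congr 1
  have h1 : (fun v => 𝓕⁻ f v - h v) =ᵐ[volume]
      ((𝓕⁻ (hf2.toLp f) - hh.toLp h : Lp ℂ 2 (volume : Measure E)) : E → ℂ) := by
    filter_upwards [fourierInv_toLp_ae_eq hf hf2, hh.coeFn_toLp,
      Lp.coeFn_sub (𝓕⁻ (hf2.toLp f)) (hh.toLp h)] with v a b c
    rw [c, Pi.sub_apply, a, b]
  have h2 : (fun v => f v - g v) =ᵐ[volume]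
      ((hf2.toLp f - 𝓕 (hh.toLp h) : Lp ℂ 2 (volume : Measure E)) : E → ℂ) := by
    filter_upwards [hg, hf2.coeFn_toLp,
      Lp.coeFn_sub (hf2.toLp f) (𝓕 (hh.toLp h))] with v a b c
    rw [c, Pi.sub_apply, a, b]
  rw [eLpNorm_congr_ae h1, eLpNorm_congr_ae h2, ← Lp.enorm_def, ← Lp.enorm_def]
  have h3 : (𝓕⁻ (hf2.toLp f) - hh.toLp h : Lp ℂ 2 (volume : Measure E)) =
      (Lp.fourierTransformₗᵢ E ℂ).symm (hf2.toLp f - 𝓕 (hh.toLp h)) := by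
    rw [map_sub]
    congr 1
    exact ((Lp.fourierTransformₗᵢ E ℂ).symm_apply_apply (hh.toLp h)).symm
  rw [h3, ← ofReal_norm, ← ofReal_norm, LinearIsometryEquiv.norm_map]

variable {U : E × Torus → ℂ} {G : E × ℤ → ℂ}

theorem lintegral_enorm_sq_eq_of_fourier (hU : MemLp U 2 (volume.prod volume))
    (hÛ : ∀ n : ℤ, MemLp (fun p => ∫ y : Torus, fourier (-n) y * U (p, y)) 2 volume)
    (hG : Measurable G)
    (hGU : ∀ n, (fun v => G (v, n)) =ᵐ[volume]
      (𝓕 ((hÛ n).toLp _) : Lp ℂ 2 (volume : Measure E))) :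
    ∫⁻ z, ‖U z‖ₑ ^ 2 ∂(volume.prod volume) = (ENNReal.ofReal (2 * Real.pi))⁻¹ *
      ∫⁻ q, ‖G q‖ₑ ^ 2 ∂((volume : Measure E).prod Measure.count) := by
  rw [lintegral_enorm_sq_prod_torus hU.1 (memLp_two_prodMk_left hU),
    lintegral_prod_count (hG.enorm.pow_const 2)]
  congr 1
  refine tsum_congr fun n => ?_
  -- Taking the density `0` turns the difference formula into plain Plancherel.
  have h := lintegral_enorm_sq_fourierInv_sub (integrable_zero E ℂ volume) MemLp.zero' (hÛ n) (hGU n)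
  simpa [Real.fourierInv_eq] using h

theorem lintegral_enorm_sq_fourierSynthesis_sub (hU : MemLp U 2 (volume.prod volume))
    (hÛ : ∀ n : ℤ, MemLp (fun p => ∫ y : Torus, fourier (-n) y * U (p, y)) 2 volume)
    (hG : Measurable G)
    (hGU : ∀ n, (fun v => G (v, n)) =ᵐ[volume]
      (𝓕 ((hÛ n).toLp _) : Lp ℂ 2 (volume : Measure E))) (N : ℕ) :
    ∫⁻ z, ‖fourierSynthesis (Finset.Icc (-(N : ℤ)) N) (freqTruncation N G) z - U z‖ₑ ^ 2
        ∂(volume.prod volume) =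
      (ENNReal.ofReal (2 * Real.pi))⁻¹ *
        ∫⁻ q, ‖freqTruncation N G q - G q‖ₑ ^ 2 ∂((volume : Measure E).prod Measure.count) := by
  have hG2 : ∀ n, MemLp (fun v => G (v, n)) 2 volume := fun n =>
    (memLp_congr_ae (hGU n)).2 (Lp.memLp _)
  have hgi : ∀ n, Integrable fun v => freqTruncation N G (v, n) := fun n =>
    integrable_freqTruncation N (hG2 n)
  have hc := continuous_fourierSynthesis (s := Finset.Icc (-(N : ℤ)) N) hgi
  have hcp : ∀ p, Continuous fun y : Torus =>
      fourierSynthesis (Finset.Icc (-(N : ℤ)) N) (freqTruncation N G) (p, y) := fun p =>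
    hc.comp (by fun_prop)
  have hs := memLp_two_prodMk_left hU
  rw [lintegral_enorm_sq_prod_torus
      (w := fun z => fourierSynthesis (Finset.Icc (-(N : ℤ)) N) (freqTruncation N G) z - U z)
      (hc.aestronglyMeasurable.sub hU.1)
      (by filter_upwards [hs] with p hp using (memLp_torus_of_continuous (hcp p)).sub hp),
    lintegral_prod_count (F := fun q => ‖freqTruncation N G q - G q‖ₑ ^ 2)
      (((measurable_freqTruncation N hG).sub hG).enorm.pow_const 2)]
  congr 1
  refine tsum_congr fun n => ?_
  rw [← lintegral_enorm_sq_fourierInv_sub (hgi n) (memLp_freqTruncation N (hG2 n)) (hÛ n) (hGU n)]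
  refine lintegral_congr_ae ?_
  filter_upwards [hs] with p hp
  have hfc : Continuous fun y : Torus => fourier (-n) y := (fourier (-n)).continuous
  have hi : Integrable fun y : Torus => fourier (-n) y * U (p, y) := by
    refine (hp.integrable (by norm_num)).bdd_mul (c := 1) hfc.aestronglyMeasurable
      (Filter.Eventually.of_forall fun y => ?_)
    rw [fourier_apply, Circle.norm_coe]
  simp only [mul_sub]
  have hi' : Integrable fun y : Torus => fourier (-n) y *
      fourierSynthesis (Finset.Icc (-(N : ℤ)) N) (freqTruncation N G) (p, y) :=
    integrable_torus_of_continuous (hfc.mul (hcp p))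
  rw [integral_sub hi' hi,
    integral_fourier_mul_fourierSynthesis fun n hn v => freqTruncation_of_notMem G hn v]

theorem tendsto_eLpNorm_fourierSynthesis_sub (hU : MemLp U 2 (volume.prod volume))
    (hÛ : ∀ n : ℤ, MemLp (fun p => ∫ y : Torus, fourier (-n) y * U (p, y)) 2 volume)
    (hG : Measurable G)
    (hGU : ∀ n, (fun v => G (v, n)) =ᵐ[volume]
      (𝓕 ((hÛ n).toLp _) : Lp ℂ 2 (volume : Measure E))) :
    Filter.Tendsto (fun N : ℕ => eLpNorm
      (fourierSynthesis (Finset.Icc (-(N : ℤ)) N) (freqTruncation N G) - U) 2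
        (volume.prod volume)) Filter.atTop (𝓝 0) := by
  have hT0 : ENNReal.ofReal (2 * Real.pi) ≠ 0 := by simpa using Real.pi_pos
  have hGf : ∫⁻ q, ‖G q‖ₑ ^ 2 ∂((volume : Measure E).prod Measure.count) ≠ ∞ := fun h => by
    have h1 := lintegral_enorm_sq_eq_of_fourier hU hÛ hG hGU
    rw [h, ENNReal.mul_top (ENNReal.inv_ne_zero.2 ENNReal.ofReal_ne_top)] at h1
    exact (lintegral_enorm_sq_lt_top hU).ne h1
  have h1 := ENNReal.Tendsto.const_mul (tendsto_lintegral_enorm_sq_freqTruncation_sub hG hGf)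
    (Or.inr (ENNReal.inv_ne_top.2 hT0))
  simp only [← lintegral_enorm_sq_fourierSynthesis_sub hU hÛ hG hGU, mul_zero] at h1
  have h2 := ((ENNReal.continuous_rpow_const (y := 1 / 2)).tendsto _).comp h1
  rw [ENNReal.zero_rpow_of_pos (by norm_num)] at h2
  refine h2.congr fun N => ?_
  rw [Function.comp_apply]
  rw [← eLpNorm_two_sq_eq_lintegral (volume.prod volume) fun z =>
    fourierSynthesis (Finset.Icc (-(N : ℤ)) N) (freqTruncation N G) z - U z,
    ← ENNReal.rpow_natCast, ← ENNReal.rpow_mul]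
  norm_num
  rfl

/-- The `L²` bilinear estimate for functions on `E × 𝕋` in terms of the supports of their
Fourier transforms. -/
theorem eLpNorm_mul_le_of_fourier_support {U₁ U₂ : E × Torus → ℂ} {G₁ G₂ : E × ℤ → ℂ}
    (hU₁ : MemLp U₁ 2 (volume.prod volume)) (hU₂ : MemLp U₂ 2 (volume.prod volume))
    (hÛ₁ : ∀ n : ℤ, MemLp (fun p => ∫ y : Torus, fourier (-n) y * U₁ (p, y)) 2 volume)
    (hÛ₂ : ∀ n : ℤ, MemLp (fun p => ∫ y : Torus, fourier (-n) y * U₂ (p, y)) 2 volume)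
    (hG₁ : Measurable G₁) (hG₂ : Measurable G₂)
    (hGU₁ : ∀ n, (fun v => G₁ (v, n)) =ᵐ[volume]
      (𝓕 ((hÛ₁ n).toLp _) : Lp ℂ 2 (volume : Measure E)))
    (hGU₂ : ∀ n, (fun v => G₂ (v, n)) =ᵐ[volume]
      (𝓕 ((hÛ₂ n).toLp _) : Lp ℂ 2 (volume : Measure E)))
    {A B : ℝ≥0∞} (hAt : A ≠ ∞) (hB : (ENNReal.ofReal (2 * Real.pi))⁻¹ * A = B ^ 2)
    (hA : ∀ z, ((volume : Measure E).prod Measure.count)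
      {q | G₁ q ≠ 0 ∧ G₂ (z - q) ≠ 0} ≤ A) :
    eLpNorm (fun z => U₁ z * U₂ z) 2 (volume.prod volume) ≤
      B * eLpNorm U₁ 2 (volume.prod volume) * eLpNorm U₂ 2 (volume.prod volume) := by
  have hT0 : ENNReal.ofReal (2 * Real.pi) ≠ 0 := by simpa using Real.pi_pos
  have hTt : ENNReal.ofReal (2 * Real.pi) ≠ ∞ := ENNReal.ofReal_ne_top
  have hfin : ∀ {U : E × Torus → ℂ} {G : E × ℤ → ℂ} (_ : MemLp U 2 (volume.prod volume))
      (hÛ : ∀ n : ℤ, MemLp (fun p => ∫ y : Torus, fourier (-n) y * U (p, y)) 2 volume)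
      (_ : Measurable G) (_ : ∀ n, (fun v => G (v, n)) =ᵐ[volume]
      (𝓕 ((hÛ n).toLp _) : Lp ℂ 2 (volume : Measure E))),
      ∫⁻ q, ‖G q‖ₑ ^ 2 ∂((volume : Measure E).prod Measure.count) =
        ENNReal.ofReal (2 * Real.pi) * eLpNorm U 2 (volume.prod volume) ^ 2 :=
    fun hU hÛ hG hGU => by
    rw [eLpNorm_two_sq_eq_lintegral, lintegral_enorm_sq_eq_of_fourier hU hÛ hG hGU, ← mul_assoc,
      ENNReal.mul_inv_cancel hT0 hTt, one_mul]
  have hslice : ∀ {U : E × Torus → ℂ} {G : E × ℤ → ℂ}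
      (hÛ : ∀ n : ℤ, MemLp (fun p => ∫ y : Torus, fourier (-n) y * U (p, y)) 2 volume)
      (_ : ∀ n, (fun v => G (v, n)) =ᵐ[volume]
      (𝓕 ((hÛ n).toLp _) : Lp ℂ 2 (volume : Measure E))) (N : ℕ) (n : ℤ),
      Integrable fun v => freqTruncation N G (v, n) := fun hÛ hGU N n =>
    integrable_freqTruncation N ((memLp_congr_ae (hGU n)).2 (Lp.memLp _))
  set V₁ : ℕ → E × Torus → ℂ := fun N =>
    fourierSynthesis (Finset.Icc (-(N : ℤ)) N) (freqTruncation N G₁) with hV₁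
  set V₂ : ℕ → E × Torus → ℂ := fun N =>
    fourierSynthesis (Finset.Icc (-(N : ℤ)) N) (freqTruncation N G₂) with hV₂
  have hc₁ : ∀ N, Continuous (V₁ N) := fun N => continuous_fourierSynthesis (hslice hÛ₁ hGU₁ N)
  have hc₂ : ∀ N, Continuous (V₂ N) := fun N => continuous_fourierSynthesis (hslice hÛ₂ hGU₂ N)
  have hmono : ∀ (N : ℕ) (G : E × ℤ → ℂ),
      ∫⁻ q, ‖freqTruncation N G q‖ₑ ^ 2 ∂((volume : Measure E).prod Measure.count) ≤
      ∫⁻ q, ‖G q‖ₑ ^ 2 ∂((volume : Measure E).prod Measure.count) := fun N G =>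
    lintegral_mono fun q => pow_le_pow_left' (enorm_freqTruncation_le N G q) 2
  have hbound : ∀ N, eLpNorm (fun z => V₁ N z * V₂ N z) 2 (volume.prod volume) ≤
      B * eLpNorm U₁ 2 (volume.prod volume) * eLpNorm U₂ 2 (volume.prod volume) := by
    intro N
    have hA' : ∀ z, ((volume : Measure E).prod Measure.count)
        {q | freqTruncation N G₁ q ≠ 0 ∧ freqTruncation N G₂ (z - q) ≠ 0} ≤ A := fun z => by
      refine (measure_mono ?_).trans (hA z)
      rintro q ⟨h1, h2⟩
      refine ⟨fun h => h1 ?_, fun h => h2 ?_⟩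
      · rcases freqTruncation_eq_or N G₁ q with h' | h' <;> simp [h', h]
      · rcases freqTruncation_eq_or N G₂ (z - q) with h' | h' <;> simp [h', h]
    have hlt : ∀ {U : E × Torus → ℂ} (_ : MemLp U 2 (volume.prod volume)),
        ENNReal.ofReal (2 * Real.pi) * eLpNorm U 2 (volume.prod volume) ^ 2 < ∞ := fun hU =>
      ENNReal.mul_lt_top hTt.lt_top (ENNReal.pow_lt_top hU.2)
    have h := lintegral_enorm_sq_fourierSynthesis_mul_le (s := Finset.Icc (-(N : ℤ)) N)
      (measurable_freqTruncation N hG₁) (measurable_freqTruncation N hG₂)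
      (fun n hn v => freqTruncation_of_notMem G₂ hn v) (hslice hÛ₁ hGU₁ N) (hslice hÛ₂ hGU₂ N)
      ((hmono N G₁).trans_lt (hfin hU₁ hÛ₁ hG₁ hGU₁ ▸ hlt hU₁))
      ((hmono N G₂).trans_lt (hfin hU₂ hÛ₂ hG₂ hGU₂ ▸ hlt hU₂)) hAt hA'
    rw [← ENNReal.pow_le_pow_left_iff two_ne_zero, eLpNorm_two_sq_eq_lintegral]
    refine h.trans ?_
    calc _ ≤ (ENNReal.ofReal (2 * Real.pi))⁻¹ ^ 3 * (A *
          ((ENNReal.ofReal (2 * Real.pi) * eLpNorm U₁ 2 (volume.prod volume) ^ 2) *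
            (ENNReal.ofReal (2 * Real.pi) * eLpNorm U₂ 2 (volume.prod volume) ^ 2))) := by
          rw [← hfin hU₁ hÛ₁ hG₁ hGU₁, ← hfin hU₂ hÛ₂ hG₂ hGU₂]
          gcongr
          · exact enorm_freqTruncation_le N G₁ _
          · exact enorm_freqTruncation_le N G₂ _
      -- The Parseval factors of `U₁` and `U₂` cancel two of the three inverse factors `2π`.
      _ = ((ENNReal.ofReal (2 * Real.pi))⁻¹ * ENNReal.ofReal (2 * Real.pi)) ^ 2 *
          ((ENNReal.ofReal (2 * Real.pi))⁻¹ * A) * (eLpNorm U₁ 2 (volume.prod volume) ^ 2 *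
            eLpNorm U₂ 2 (volume.prod volume) ^ 2) := by ring
      _ = _ := by
          rw [ENNReal.inv_mul_cancel hT0 hTt, hB]; ring
  -- `L²` convergence gives almost everywhere convergence along a subsequence; the second extraction
  -- is made inside the first, so that the products converge and Fatou applies.
  have ht₁ := tendstoInMeasure_of_tendsto_eLpNorm two_ne_zero
    (fun N => (hc₁ N).aestronglyMeasurable) hU₁.1
    (tendsto_eLpNorm_fourierSynthesis_sub hU₁ hÛ₁ hG₁ hGU₁)
  obtain ⟨ns, hns, hae₁⟩ := ht₁.exists_seq_tendsto_ae
  have ht₂ := tendstoInMeasure_of_tendsto_eLpNorm two_ne_zero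
    (fun N => (hc₂ (ns N)).aestronglyMeasurable) hU₂.1
    ((tendsto_eLpNorm_fourierSynthesis_sub hU₂ hÛ₂ hG₂ hGU₂).comp hns.tendsto_atTop)
  obtain ⟨ms, hms, hae₂⟩ := ht₂.exists_seq_tendsto_ae
  refine (Lp.eLpNorm_lim_le_liminf_eLpNorm
    (f := fun k z => V₁ (ns (ms k)) z * V₂ (ns (ms k)) z)
    (fun k => ((hc₁ _).mul (hc₂ _)).aestronglyMeasurable) _ ?_).trans ?_
  · filter_upwards [hae₁, hae₂] with z h1 h2
    exact (h1.comp hms.tendsto_atTop).mul h2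
  · refine Filter.liminf_le_of_frequently_le' (Filter.Frequently.of_forall fun k => ?_)
    exact hbound _

end Truncation

/-! ### From the support hypothesis to the bilinear estimate. -/

theorem isClosed_hyperbolicRegion (α K : ℝ) : IsClosed (hyperbolicRegion α K) := by
  have h1 : Continuous fun n : ℤ => |(n : ℝ)| ^ (2 * α) := continuous_of_discreteTopology
  have h2 : Continuous fun q : ℝ × ℝ × ℤ => |q.1 + q.2.1 ^ 2 - |(q.2.2 : ℝ)| ^ (2 * α)| :=
    ((continuous_fst.add (continuous_snd.fst.pow 2)).sub
      (h1.comp continuous_snd.snd)).abs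
  exact (isClosed_le continuous_const h2).inter (isClosed_le h2 continuous_const)

/-- Every integer has positive counting mass, so no slice `n` is exceptional. A measurable null
superset replaces the exceptional set, which need not be measurable. -/
theorem ae_prod_of_ae_freqMeasure {P : ℝ × ℝ × ℤ → Prop} (h : ∀ᵐ q ∂freqMeasure, P q) (n : ℤ) :
    ∀ᵐ v : ℝ × ℝ, P (v.1, v.2, n) := by
  obtain ⟨S, hS, hSm, hS0⟩ := exists_measurable_superset_of_null (ae_iff.1 h)
  have hm : MeasurableSet ((fun v : ℝ × ℝ => (v.1, v.2, n)) ⁻¹' S) :=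
    (measurable_fst.prodMk (measurable_snd.prodMk measurable_const)) hSm
  refine ae_iff.2 (measure_mono_null (t := (fun v : ℝ × ℝ => (v.1, v.2, n)) ⁻¹' S)
    (fun v hv => hS hv) ?_)
  rw [Measure.volume_eq_prod, Measure.measure_prod_null hm]
  have h1 : ∀ᵐ q ∂freqMeasure, q ∉ S := measure_eq_zero_iff_ae_notMem.1 hS0
  filter_upwards [Measure.ae_ae_of_ae_prod h1] with a ha
  refine measure_eq_zero_iff_ae_notMem.2 ?_
  filter_upwards [Measure.ae_ae_of_ae_prod ha] with b hb
  exact Measure.ae_count_iff.1 hb n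

theorem ae_of_ae_prod_two_pi_smul {P : ℝ × ℝ → Prop} (h : ∀ᵐ v : ℝ × ℝ, P v) :
    ∀ᵐ v : WithLp 2 (ℝ × ℝ), P (2 * Real.pi * v.fst, 2 * Real.pi * v.snd) := by
  have h1 : ∀ᵐ v : ℝ × ℝ, P ((2 * Real.pi) • v) := by
    rw [ae_iff] at h ⊢
    have := Measure.addHaar_preimage_smul (volume : Measure (ℝ × ℝ)) Real.two_pi_pos.ne'
      {v | ¬ P v}
    rw [h, mul_zero] at this
    exact this
  exact (WithLp.volume_preserving_ofLp ℝ ℝ).quasiMeasurePreserving.ae h1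

theorem measurePreserving_withLp_prodAssoc :
    MeasurePreserving (fun q : WithLp 2 (ℝ × ℝ) × Torus => (q.1.fst, q.1.snd, q.2))
      (volume.prod volume) volume :=
  (volume_preserving_prodAssoc (α₁ := ℝ) (β₁ := ℝ) (γ₁ := Torus)).comp
    ((WithLp.volume_preserving_ofLp ℝ ℝ).prod (MeasurePreserving.id (volume : Measure Torus)))

/-- A pointwise representative of the space-time Fourier transform in rescaled frequencies which
vanishes outside of the region `|τ + ξ² - |n|^{2α}| ≤ 2K`. -/
theorem exists_measurable_fourier_representative {α K : ℝ} {u : ℝ × ℝ × Torus → ℂ}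
    (hu : MemLp u 2 volume)
    (h : essSupport freqMeasure (spaceTimeFourier u hu) ⊆ hyperbolicRegion α K) :
    ∃ G : WithLp 2 (ℝ × ℝ) × ℤ → ℂ, Measurable G ∧
      (∀ n, (fun v => G (v, n)) =ᵐ[volume] (𝓕 ((memLp_torusFourier hu n).toLp _) :
        Lp ℂ 2 (volume : Measure (WithLp 2 (ℝ × ℝ))))) ∧
      ∀ q, G q ≠ 0 → |scaledPhase α q| ≤ 2 * K := by
  rw [essSupport_subset_iff _ _ (isClosed_hyperbolicRegion α K)] at h
  set S := {q : WithLp 2 (ℝ × ℝ) × ℤ | |scaledPhase α q| ≤ 2 * K} with hS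
  have hSm : MeasurableSet S := measurableSet_le (measurable_scaledPhase α).abs measurable_const
  set G₀ : WithLp 2 (ℝ × ℝ) × ℤ → ℂ := fun q => (𝓕 ((memLp_torusFourier hu q.2).toLp _) :
        Lp ℂ 2 (volume : Measure (WithLp 2 (ℝ × ℝ)))) q.1 with hG₀
  have hG₀m : Measurable G₀ :=
    measurable_from_prod_countable_left fun n =>
      (Lp.stronglyMeasurable (𝓕 ((memLp_torusFourier hu n).toLp _) :
        Lp ℂ 2 (volume : Measure (WithLp 2 (ℝ × ℝ))))).measurable
  -- Cutting off to `S` changes each slice only on a null set, by the support hypothesis, and makes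
  -- the support condition hold at every point.
  refine ⟨S.indicator G₀, hG₀m.indicator hSm, fun n => ?_, fun q hq => ?_⟩
  · filter_upwards [ae_of_ae_prod_two_pi_smul (ae_prod_of_ae_freqMeasure h n)] with v hv
    by_cases hvS : (v, n) ∈ S
    · rw [Set.indicator_of_mem hvS]
    · rw [Set.indicator_of_notMem hvS]
      have h0 := hv fun hmem => hvS hmem.2
      have h3 : WithLp.toLp 2 (2 * Real.pi * v.fst / (2 * Real.pi),
          2 * Real.pi * v.snd / (2 * Real.pi)) = v := by
        rw [mul_div_cancel_left₀ _ Real.two_pi_pos.ne', mul_div_cancel_left₀ _ Real.two_pi_pos.ne']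
        rfl
      simp only [spaceTimeFourier] at h0
      rw [h3] at h0
      exact h0.symm
  · by_contra hqS
    exact hq (Set.indicator_of_notMem (s := S) hqS _)

theorem proposition2p3 (α : ℝ) (hα : 1 < α) :
    ∃ c : ℝ, 0 < c ∧
      ∀ K₁ K₂ : ℝ, 0 < K₁ → 0 < K₂ → 1 ≤ max K₁ K₂ →
      ∀ (u₁ u₂ : ℝ × ℝ × Torus → ℂ) (hu₁ : MemLp u₁ 2 volume) (hu₂ : MemLp u₂ 2 volume),
        essSupport freqMeasure (spaceTimeFourier u₁ hu₁) ⊆ hyperbolicRegion α K₁ →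
        essSupport freqMeasure (spaceTimeFourier u₂ hu₂) ⊆ hyperbolicRegion α K₂ →
        eLpNorm (fun z => u₁ z * u₂ z) 2 volume ≤
          ENNReal.ofReal (c * (K₁ * K₂) ^ (1 / 2 : ℝ)) *
            eLpNorm u₁ 2 volume * eLpNorm u₂ 2 volume := by
  obtain ⟨C, hC, hmeas⟩ := exists_measure_scaledPhase_inter_le hα
  have hpi := Real.two_pi_pos
  -- The constant is forced by `(2π)⁻¹ A = B²` with `A = C K₁ K₂`.
  refine ⟨√(C / (2 * Real.pi)), by positivity, ?_⟩
  intro K₁ K₂ h₁ h₂ hK u₁ u₂ hu₁ hu₂ hs₁ hs₂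
  obtain ⟨G₁, hG₁, hGU₁, hGs₁⟩ := exists_measurable_fourier_representative hu₁ hs₁
  obtain ⟨G₂, hG₂, hGU₂, hGs₂⟩ := exists_measurable_fourier_representative hu₂ hs₂
  have hmp := measurePreserving_withLp_prodAssoc
  have hB : (ENNReal.ofReal (2 * Real.pi))⁻¹ * ENNReal.ofReal (C * (K₁ * K₂)) =
      ENNReal.ofReal (√(C / (2 * Real.pi)) * (K₁ * K₂) ^ (1 / 2 : ℝ)) ^ 2 := by
    rw [← ENNReal.ofReal_inv_of_pos hpi, ← ENNReal.ofReal_mul (by positivity),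
      ← ENNReal.ofReal_pow (by positivity), mul_pow, Real.sq_sqrt (by positivity),
      ← Real.sqrt_eq_rpow, Real.sq_sqrt (by positivity)]
    congr 1; ring
  have key := eLpNorm_mul_le_of_fourier_support
    (hu₁.comp_measurePreserving hmp) (hu₂.comp_measurePreserving hmp)
    (memLp_torusFourier hu₁) (memLp_torusFourier hu₂) hG₁ hG₂ hGU₁ hGU₂ ENNReal.ofReal_ne_top hB
    fun z => (measure_mono (Set.ofPred_subset_ofPred.2 fun q hq =>
      ⟨hGs₁ q hq.1, hGs₂ _ hq.2⟩)).trans (hmeas K₁ K₂ h₁ h₂ hK z)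
  rw [eLpNorm_comp_measurePreserving hu₁.1 hmp, eLpNorm_comp_measurePreserving hu₂.1 hmp] at key
  rw [← eLpNorm_comp_measurePreserving (g := fun z => u₁ z * u₂ z) (hu₁.1.mul hu₂.1) hmp]
  exact key
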